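/- Let $\mathbb{T}=\mathbb{R}/\mathbb{Z}$ be the circle of length $1$, and let $\mathrm{Diff}^k(\mathbb{T})$ be the set of orientation-preserving $C^k$-diffeomorphisms of $\mathbb{T}$; $\mathrm{Diff}^1(\mathbb{T})$ carries the $C^1$-topology and its Borel $\sigma$-algebra. For $\psi\in\mathrm{Diff}^3(\mathbb{T})$ write $\mathcal{S}_\psi=\left(\frac{\psi''}{\psi'}\right)'-\frac12\left(\frac{\psi''}{\psi'}\right)^2$ for its Schwarzian derivative. Fix $\sigma^2>0$; the parameter $\alpha$ is a complex number with $\alpha^2\in\mathbb{R}$. A Radon measure $\mu$ on $\mathrm{Diff}^1(\mathbb{T})$ is called an unquotiented $\alpha$-orbital measure if for every $\psi\in\mathrm{Diff}^3(\mathbb{T})$ the pullback $\psi^*\mu(A)=\mu(\psi\circ A)$ is absolutely continuous with respect to $\mu$ with density $$\frac{\mathrm{d}\psi^*\mu}{\mathrm{d}\mu}(\phi)=\exp\left\{\frac1{\sigma^2}\int_{\mathbb{T}}\Big[\mathcal{S}_\psi(\phi(\tau))+2\alpha^2\big(\psi'(\phi(\tau))^2-1\big)\Big]\phi'(\tau)^2\,\mathrm{d}\tau\right\}.$$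 Let $\mathcal{M}^{\alpha_0}$ be an unquotiented $\alpha_0$-orbital measure for some $\alpha_0$ with $\alpha_0^2\in\mathbb{R}$, and for all $\alpha^2\in\mathbb{R}$ let $$\mathrm{d}\mathcal{M}^{\alpha}(\phi)=\exp\left\{\frac{2(\alpha^2-\alpha_0^2)}{\sigma^2}\int_{\mathbb{T}}\phi'(\tau)^2\,\mathrm{d}\tau\right\}\mathrm{d}\mathcal{M}^{\alpha_0}(\phi).$$ Assume that the family is regular, i.e. $\mathcal{M}^{\alpha}$ has finite total mass for at least one $\alpha^2\in\mathbb{R}$. Write $\mathcal{Z}(\sigma^2,\alpha)=\mathcal{M}^{\alpha}(\mathrm{Diff}^1(\mathbb{T}))$ for the total mass. Then for every $\alpha$ with $\alpha^2\in\mathbb{R}$ and $\alpha^2<\pi^2$, the total mass $\mathcal{Z}(\sigma^2,\alpha)$ is finite and $$\mathcal{Z}(\sigma^2,\alpha)=\frac{\alpha}{\sin\alpha}\,e^{2\alpha^2/\sigma^2}\,\mathcal{Z}(\sigma^2,0),$$ where $\frac{\alpha}{\sin\alpha}$ is understood as $1$ for $\alpha=0$. -/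

import Mathlib

open MeasureTheory
open scoped ENNReal

noncomputable section

/-- The Schwarzian derivative `S(f, x) = (f'' / f')'(x) - (1/2) (f''(x) / f'(x))²`. -/
def schwarzian (f : ℝ → ℝ) (x : ℝ) : ℝ :=
  deriv (fun y => deriv (deriv f) y / deriv f y) x - 1 / 2 * (deriv (deriv f) x / deriv f x) ^ 2

/-- `Φ : ℝ → ℝ` is the lift of an orientation-preserving `C^k`-diffeomorphism of the unit circle
`ℝ / ℤ`: it is `C^k`, has positive derivative, and commutes with the translation by `1`. -/
structure IsDiffLift (k : ℕ) (Φ : ℝ → ℝ) : Prop where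
  contDiff : ContDiff ℝ k Φ
  deriv_pos : ∀ x, 0 < deriv Φ x
  map_add_one : ∀ x, Φ (x + 1) = Φ x + 1

theorem IsDiffLift.deriv_periodic {k : ℕ} {Φ : ℝ → ℝ} (h : IsDiffLift k Φ) :
    Function.Periodic (deriv Φ) 1 := by
  intro x
  have h1 : (fun y => Φ (y + 1)) = fun y => Φ y + 1 := funext h.map_add_one
  rw [← deriv_comp_add_const Φ 1 x, h1, deriv_add_const]

theorem periodic_deriv_one {g : ℝ → ℝ} (h : Function.Periodic g 1) :
    Function.Periodic (deriv g) 1 := by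
  intro x
  have h1 : (fun y => g (y + 1)) = g := funext h
  rw [← deriv_comp_add_const g 1 x, h1]

theorem IsDiffLift.schwarzian_periodic {k : ℕ} {Φ : ℝ → ℝ} (h : IsDiffLift k Φ) :
    Function.Periodic (schwarzian Φ) 1 := by
  have h1 := h.deriv_periodic
  have h2 := periodic_deriv_one h1
  have h3 := periodic_deriv_one (g := fun y => deriv (deriv Φ) y / deriv Φ y)
    (fun y => by simp only [h1 y, h2 y])
  intro x
  simp only [schwarzian, h1 x, h2 x, h3 x]

/-- `Diff^k(𝕋)` for `k ≥ 1`: the orientation-preserving `C^k`-diffeomorphisms of the circle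
`𝕋 = ℝ / ℤ`. They are exactly the self-maps of `𝕋` induced by some `Φ` with `IsDiffLift k Φ`. -/
@[ext]
structure CircleDiff (k : ℕ) where
  toFun : UnitAddCircle → UnitAddCircle
  exists_lift : ∃ Φ : ℝ → ℝ, IsDiffLift k Φ ∧ ∀ x : ℝ, toFun (x : UnitAddCircle) = (Φ x : ℝ)

namespace CircleDiff

variable {k : ℕ}

/-- A lift to `ℝ`; it is determined up to an integer constant, and only quantities that do not
depend on that constant are formed from it. -/
def lift (φ : CircleDiff k) : ℝ → ℝ := φ.exists_lift.choose

theorem isDiffLift_lift (φ : CircleDiff k) : IsDiffLift k φ.lift :=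
  φ.exists_lift.choose_spec.1

theorem coe_lift (φ : CircleDiff k) (x : ℝ) : φ.toFun (x : UnitAddCircle) = (φ.lift x : ℝ) :=
  φ.exists_lift.choose_spec.2 x

/-- The derivative `φ' : 𝕋 → ℝ`. -/
def deriv (φ : CircleDiff k) : UnitAddCircle → ℝ :=
  φ.isDiffLift_lift.deriv_periodic.lift

/-- The Schwarzian derivative `S_φ : 𝕋 → ℝ` (meaningful for `k ≥ 3`). -/
def schwarzian (φ : CircleDiff k) : UnitAddCircle → ℝ :=
  φ.isDiffLift_lift.schwarzian_periodic.lift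

theorem continuous_toFun (φ : CircleDiff k) : Continuous φ.toFun := by
  refine (QuotientAddGroup.isQuotientMap_mk (N := AddSubgroup.zmultiples (1 : ℝ))).continuous_iff.2 ?_
  have h : (φ.toFun ∘ fun x : ℝ => (x : UnitAddCircle)) = fun x => ((φ.lift x : ℝ) : UnitAddCircle) :=
    funext φ.coe_lift
  exact h ▸ (AddCircle.continuous_mk' 1).comp φ.isDiffLift_lift.contDiff.continuous

theorem continuous_deriv (φ : CircleDiff 1) : Continuous φ.deriv :=
  continuous_quot_lift _ (φ.isDiffLift_lift.contDiff.continuous_deriv le_rfl)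

/-- The `C¹`-topology on `Diff¹(𝕋)`: uniform convergence of `φ` and of `φ'`. -/
instance : TopologicalSpace (CircleDiff 1) :=
  TopologicalSpace.induced
    (fun φ => ((⟨φ.toFun, φ.continuous_toFun⟩, ⟨φ.deriv, φ.continuous_deriv⟩) :
      C(UnitAddCircle, UnitAddCircle) × C(UnitAddCircle, ℝ)))
    inferInstance

instance : MeasurableSpace (CircleDiff 1) := borel _

instance : BorelSpace (CircleDiff 1) := ⟨rfl⟩

/-- Post-composition `φ ↦ ψ ∘ φ` of `φ ∈ Diff¹(𝕋)` with `ψ ∈ Diff³(𝕋)`. -/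
def postcomp (ψ : CircleDiff 3) (φ : CircleDiff 1) : CircleDiff 1 where
  toFun := ψ.toFun ∘ φ.toFun
  exists_lift := by
    have hψ := ψ.isDiffLift_lift
    have hφ := φ.isDiffLift_lift
    have hψ1 : ContDiff ℝ 1 ψ.lift := hψ.contDiff.of_le (by norm_num)
    refine ⟨ψ.lift ∘ φ.lift, ⟨hψ1.comp hφ.contDiff, fun x => ?_, fun x => ?_⟩, fun x => ?_⟩
    · rw [deriv_comp x (hψ1.differentiable one_ne_zero _)
        (hφ.contDiff.differentiable one_ne_zero _)]
      exact mul_pos (hψ.deriv_pos _) (hφ.deriv_pos _)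
    · simp only [Function.comp_apply, hφ.map_add_one, hψ.map_add_one]
    · simp only [Function.comp_apply, coe_lift]

/-- The Dirichlet energy `∫_𝕋 φ'(τ)² dτ`, with `𝕋` of total length `1`. -/
def energy (φ : CircleDiff 1) : ℝ := ∫ τ : UnitAddCircle, φ.deriv τ ^ 2

end CircleDiff

/-- Radon measure: locally finite and inner regular with respect to compact sets. -/
def IsRadonMeasure (μ : Measure (CircleDiff 1)) : Prop :=
  IsLocallyFiniteMeasure μ ∧ μ.InnerRegular

/-- The density
`exp {(1/σ²) ∫_𝕋 [S_ψ(φ(τ)) + 2 α² (ψ'(φ(τ))² - 1)] φ'(τ)² dτ}` of the change of variables formula;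
here `σsq` stands for `σ²` and `a` for the real number `α²`. -/
def orbitalDensity (σsq a : ℝ) (ψ : CircleDiff 3) (φ : CircleDiff 1) : ℝ :=
  Real.exp (1 / σsq * ∫ τ : UnitAddCircle,
    (ψ.schwarzian (φ.toFun τ) + 2 * a * (ψ.deriv (φ.toFun τ) ^ 2 - 1)) * φ.deriv τ ^ 2)

/-- `μ` is an unquotiented Virasoro `α`-orbital measure, with `σsq = σ²` and `a = α²`: a Radon
measure such that, for all `ψ ∈ Diff³(𝕋)`, the pullback `ψ^* μ : A ↦ μ (ψ ∘ A)` is absolutely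
continuous with respect to `μ` with density `orbitalDensity σsq a ψ`. -/
structure IsOrbitalMeasure (σsq a : ℝ) (μ : Measure (CircleDiff 1)) : Prop where
  radon : IsRadonMeasure μ
  change_of_variables : ∀ ψ : CircleDiff 3, ∀ A : Set (CircleDiff 1), MeasurableSet A →
    μ (ψ.postcomp '' A) = ∫⁻ φ in A, ENNReal.ofReal (orbitalDensity σsq a ψ φ) ∂μ

/-- The reweighted measure `exp {(2 (α² - α₀²) / σ²) ∫_𝕋 φ'(τ)² dτ} dμ(φ)`, with `σsq = σ²`,
`a₀ = α₀²`, `a = α²`. -/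
def changeOfOrbit (σsq a₀ a : ℝ) (μ : Measure (CircleDiff 1)) : Measure (CircleDiff 1) :=
  μ.withDensity fun φ => ENNReal.ofReal (Real.exp (2 * (a - a₀) / σsq * φ.energy))

/-- A regular unquotiented orbital measure: some reweighting of it has finite total mass. -/
structure IsRegularOrbitalMeasure (σsq a₀ : ℝ) (μ : Measure (CircleDiff 1)) : Prop where
  orbital : IsOrbitalMeasure σsq a₀ μ
  regular : ∃ a : ℝ, changeOfOrbit σsq a₀ a μ Set.univ < ∞

/-- A family `a = α² ↦ μ a` of measures obtained from one regular unquotiented orbital measure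
`μ a₀` by exponential reweighting. -/
def IsRegularOrbitalFamily (σsq : ℝ) (μ : ℝ → Measure (CircleDiff 1)) : Prop :=
  ∃ a₀ : ℝ, IsRegularOrbitalMeasure σsq a₀ (μ a₀) ∧ ∀ a : ℝ, μ a = changeOfOrbit σsq a₀ a (μ a₀)

/-- `α / sin α`, equal to `1` at `α = 0`. -/
def divSin (α : ℂ) : ℂ := if α = 0 then 1 else α / Complex.sin α

end

/-!
Write `Z a` for the total mass of the measure with parameter `a = α²`. The case `a = 0` of the
change of variables formula, applied to the density `exp (2 a ∫ φ'² / σ²)`, shows that `Z a` is the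
integral of `exp (σ⁻² ∫ W(φ) φ'²)` against the measure with parameter `0`, with the potential
`W = S_ψ + 2 a (ψ')²` of any diffeomorphism `ψ`. A Hill equation in the hyperbolic regime
produces, for `0 < b < l`, diffeomorphisms with `a = -l²` whose potentials are `-2 b²` minus
approximations of a point mass of weight `4 b (cosh l - cosh b) / sinh b`. Rotating `ψ` and
averaging over the rotation angle turns the point mass into a Laplace variable conjugate to `φ'`,
and integrating over that variable gives the integral equation
`Z (-b²) = ∫_b^∞ 4 b sinh l / (σ² sinh b) Z (-l²) dl`.
Its solutions are the multiples of `(b / sinh b) exp (-2 b² / σ²)`, which determines `Z` far to the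
left. Since `Z` is the Laplace transform of a positive measure and `(α / sin α) exp (2 α² / σ²)` is
a holomorphic function of `α²` on discs that reach up to `π²`, positivity of the Taylor coefficients
of `Z` carries the formula to all `a < π²`.
-/

open Filter Topology

/-! ### Lifts of circle diffeomorphisms -/

section Lifts

variable {k : ℕ} {Φ Ψ : ℝ → ℝ}

theorem IsDiffLift.of_le {m : ℕ} (h : IsDiffLift k Φ) (hm : m ≤ k) : IsDiffLift m Φ :=
  ⟨h.contDiff.of_le (by exact_mod_cast hm), h.deriv_pos, h.map_add_one⟩

theorem IsDiffLift.hasDerivAt (h : IsDiffLift k Φ) (x : ℝ) : HasDerivAt Φ (deriv Φ x) x :=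
  (differentiableAt_of_deriv_ne_zero (h.deriv_pos x).ne').hasDerivAt

theorem IsDiffLift.continuous_deriv (h : IsDiffLift k Φ) (hk : 1 ≤ k) : Continuous (deriv Φ) :=
  h.contDiff.continuous_deriv (by exact_mod_cast hk)

theorem IsDiffLift.strictMono (h : IsDiffLift k Φ) : StrictMono Φ :=
  strictMono_of_deriv_pos h.deriv_pos

theorem IsDiffLift.map_add_int (h : IsDiffLift k Φ) (x : ℝ) (n : ℤ) : Φ (x + n) = Φ x + n := by
  have hper : Function.Periodic (fun y => Φ y - y) 1 := fun y => by
    simp only [h.map_add_one, add_sub_add_right_eq_sub]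
  have := hper.int_mul n x
  simp only [mul_one] at this
  linarith

theorem IsDiffLift.surjective (h : IsDiffLift k Φ) : Function.Surjective Φ := by
  intro y
  have hint : ∀ n : ℤ, Φ n = Φ 0 + n := fun n => by simpa using h.map_add_int 0 n
  have hlt := Int.lt_floor_add_one (y - Φ 0)
  have hle := Int.floor_le (y - Φ 0)
  obtain ⟨x, -, hx⟩ := intermediate_value_Icc (a := ((⌊y - Φ 0⌋ : ℤ) : ℝ))
    (b := ((⌊y - Φ 0⌋ + 1 : ℤ) : ℝ)) (by push_cast; linarith) h.contDiff.continuous.continuousOn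
    (show y ∈ _ by rw [hint, hint]; push_cast; constructor <;> linarith)
  exact ⟨x, hx⟩

theorem IsDiffLift.comp (hΨ : IsDiffLift k Ψ) (hΦ : IsDiffLift k Φ) : IsDiffLift k (Ψ ∘ Φ) where
  contDiff := hΨ.contDiff.comp hΦ.contDiff
  deriv_pos x := by
    rw [((hΨ.hasDerivAt (Φ x)).comp x (hΦ.hasDerivAt x)).deriv]
    exact mul_pos (hΨ.deriv_pos _) (hΦ.deriv_pos _)
  map_add_one x := by simp only [Function.comp_apply, hΦ.map_add_one, hΨ.map_add_one]

theorem IsDiffLift.exists_rightInverse (h : IsDiffLift k Φ) :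
    ∃ Θ, IsDiffLift k Θ ∧ Function.RightInverse Θ Φ := by
  let e := (StrictMono.orderIsoOfSurjective Φ h.strictMono h.surjective).toHomeomorph
  have he : ∀ y, Φ (e.symm y) = y := e.apply_symm_apply
  have hderiv : ∀ y, HasDerivAt e.symm (deriv Φ (e.symm y))⁻¹ y := fun y =>
    HasDerivAt.of_local_left_inverse e.symm.continuous.continuousAt (h.hasDerivAt _)
      (h.deriv_pos _).ne' (Eventually.of_forall he)
  refine ⟨e.symm, ⟨e.contDiff_symm_deriv (fun x => (h.deriv_pos x).ne') h.hasDerivAt h.contDiff,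
    fun y => ?_, fun y => ?_⟩, he⟩
  · rw [(hderiv y).deriv]
    exact inv_pos.2 (h.deriv_pos _)
  · apply h.strictMono.injective
    rw [h.map_add_one, he, he]

theorem IsDiffLift.comp_sub_const (h : IsDiffLift k Φ) (θ : ℝ) :
    IsDiffLift k (fun x => Φ (x - θ)) where
  contDiff := h.contDiff.comp (contDiff_id.sub contDiff_const)
  deriv_pos x := by rw [deriv_comp_sub_const]; exact h.deriv_pos _
  map_add_one x := by rw [add_sub_right_comm, h.map_add_one]

theorem schwarzian_comp_sub_const (f : ℝ → ℝ) (θ x : ℝ) :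
    schwarzian (fun y => f (y - θ)) x = schwarzian f (x - θ) := by
  have hderiv : deriv (fun y => f (y - θ)) = fun y => deriv f (y - θ) :=
    funext fun y => deriv_comp_sub_const f θ y
  have hderiv₂ : deriv (fun y => deriv f (y - θ)) = fun y => deriv (deriv f) (y - θ) :=
    funext fun y => deriv_comp_sub_const (deriv f) θ y
  have hquot := deriv_comp_sub_const (fun y => deriv (deriv f) y / deriv f y) θ x
  simp only [schwarzian, hderiv, hderiv₂, hquot]

theorem schwarzian_add_const (f : ℝ → ℝ) (c x : ℝ) :
    schwarzian (fun y => f y + c) x = schwarzian f x := by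
  have hderiv : deriv (fun y => f y + c) = deriv f := funext fun y => deriv_add_const c
  simp only [schwarzian, hderiv]

theorem continuous_schwarzian {f : ℝ → ℝ} (hf : ContDiff ℝ 3 f) (hf' : ∀ x, deriv f x ≠ 0) :
    Continuous (schwarzian f) := by
  have hderiv : ContDiff ℝ 2 (deriv f) := (contDiff_succ_iff_deriv.1 hf).2.2
  have hderiv₂ : ContDiff ℝ 1 (deriv (deriv f)) := (contDiff_succ_iff_deriv.1 hderiv).2.2
  have hquot : ContDiff ℝ 1 (fun y => deriv (deriv f) y / deriv f y) :=
    hderiv₂.div (hderiv.of_le one_le_two) hf'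
  exact (hquot.continuous_deriv le_rfl).sub (continuous_const.mul (hquot.continuous.pow 2))

end Lifts

namespace CircleDiff

section Basic

variable {k : ℕ}

theorem lift_eq_add_const {φ : CircleDiff k} {Φ : ℝ → ℝ} (h : IsDiffLift k Φ)
    (hφ : ∀ x : ℝ, φ.toFun (x : UnitAddCircle) = (Φ x : ℝ)) :
    ∃ c : ℝ, φ.lift = fun x => Φ x + c := by
  have hint : ∀ x, ∃ n : ℤ, (n : ℝ) = φ.lift x - Φ x := fun x => by
    have : ((φ.lift x - Φ x : ℝ) : UnitAddCircle) = 0 := by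
      rw [AddCircle.coe_sub, sub_eq_zero, ← hφ, φ.coe_lift]
    simpa using (AddCircle.coe_eq_zero_iff 1).1 this
  choose n hn using hint
  have hc : Continuous n := by
    rw [Int.isClosedEmbedding_coe_real.isEmbedding.continuous_iff]
    exact (funext hn : ((↑) : ℤ → ℝ) ∘ n = _) ▸
      φ.isDiffLift_lift.contDiff.continuous.sub h.contDiff.continuous
  refine ⟨n 0, funext fun x => ?_⟩
  rw [PreconnectedSpace.constant inferInstance hc (x := 0) (y := x), hn]
  ring

theorem deriv_coe {φ : CircleDiff k} {Φ : ℝ → ℝ} (h : IsDiffLift k Φ)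
    (hφ : ∀ x : ℝ, φ.toFun (x : UnitAddCircle) = (Φ x : ℝ)) (x : ℝ) :
    φ.deriv (x : UnitAddCircle) = _root_.deriv Φ x := by
  obtain ⟨c, hc⟩ := lift_eq_add_const h hφ
  change _root_.deriv φ.lift x = _
  rw [hc, deriv_add_const]

theorem schwarzian_coe {φ : CircleDiff k} {Φ : ℝ → ℝ} (h : IsDiffLift k Φ)
    (hφ : ∀ x : ℝ, φ.toFun (x : UnitAddCircle) = (Φ x : ℝ)) (x : ℝ) :
    φ.schwarzian (x : UnitAddCircle) = _root_.schwarzian Φ x := by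
  obtain ⟨c, hc⟩ := lift_eq_add_const h hφ
  change _root_.schwarzian φ.lift x = _
  rw [hc, schwarzian_add_const]

theorem deriv_pos (φ : CircleDiff k) (x : UnitAddCircle) : 0 < φ.deriv x := by
  induction x using QuotientAddGroup.induction_on with
  | H x => exact φ.isDiffLift_lift.deriv_pos x

theorem continuous_deriv_of_one_le (φ : CircleDiff k) (hk : 1 ≤ k) : Continuous φ.deriv :=
  continuous_quot_lift _ (φ.isDiffLift_lift.continuous_deriv hk)

theorem continuous_schwarzian (ψ : CircleDiff 3) : Continuous ψ.schwarzian :=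
  continuous_quot_lift _ (_root_.continuous_schwarzian ψ.isDiffLift_lift.contDiff fun x =>
    (ψ.isDiffLift_lift.deriv_pos x).ne')

theorem surjective_toFun (φ : CircleDiff k) : Function.Surjective φ.toFun := by
  intro x
  obtain ⟨r, rfl⟩ := QuotientAddGroup.mk_surjective x
  obtain ⟨s, rfl⟩ := φ.isDiffLift_lift.surjective r
  exact ⟨s, φ.coe_lift s⟩

theorem injective_toFun (φ : CircleDiff k) : Function.Injective φ.toFun := by
  intro x y hxy
  induction x using QuotientAddGroup.induction_on with | H x => ?_
  induction y using QuotientAddGroup.induction_on with | H y => ?_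
  change φ.toFun (x : UnitAddCircle) = φ.toFun (y : UnitAddCircle) at hxy
  have hzero : ((φ.lift x - φ.lift y : ℝ) : UnitAddCircle) = 0 := by
    rw [AddCircle.coe_sub, ← coe_lift, ← coe_lift, hxy, sub_self]
  obtain ⟨n, hn⟩ := (AddCircle.coe_eq_zero_iff 1).1 hzero
  have hx : φ.lift x = φ.lift (y + n) := by
    rw [φ.isDiffLift_lift.map_add_int]
    simp only [zsmul_eq_mul, mul_one] at hn
    linarith
  change (x : UnitAddCircle) = (y : UnitAddCircle)
  rw [φ.isDiffLift_lift.strictMono.injective hx, AddCircle.coe_add, add_eq_left,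
    AddCircle.coe_eq_zero_iff]
  exact ⟨n, by simp⟩

/-- The circle diffeomorphism induced by a lift. -/
def ofLift (Φ : ℝ → ℝ) (h : IsDiffLift k Φ) : CircleDiff k where
  toFun := Function.Periodic.lift (f := fun x => ((Φ x : ℝ) : UnitAddCircle)) (c := 1)
    fun x => by
      beta_reduce
      rw [h.map_add_one, AddCircle.coe_add, AddCircle.coe_period, add_zero]
  exists_lift := ⟨Φ, h, fun _ => rfl⟩

/-- Precomposition `x ↦ ψ (x - θ)` with a rotation. -/
def compSub (ψ : CircleDiff k) (θ : UnitAddCircle) : CircleDiff k where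
  toFun x := ψ.toFun (x - θ)
  exists_lift := by
    obtain ⟨r, rfl⟩ := QuotientAddGroup.mk_surjective θ
    exact ⟨_, ψ.isDiffLift_lift.comp_sub_const r, fun x => ψ.coe_lift (x - r)⟩

theorem deriv_compSub (ψ : CircleDiff k) (θ x : UnitAddCircle) :
    (ψ.compSub θ).deriv x = ψ.deriv (x - θ) := by
  induction x using QuotientAddGroup.induction_on with | H x => ?_
  induction θ using QuotientAddGroup.induction_on with | H r => ?_
  exact (deriv_coe (φ := ψ.compSub r) (ψ.isDiffLift_lift.comp_sub_const r)
    (fun x => ψ.coe_lift (x - r)) x).trans (deriv_comp_sub_const ψ.lift r x)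

theorem schwarzian_compSub (ψ : CircleDiff k) (θ x : UnitAddCircle) :
    (ψ.compSub θ).schwarzian x = ψ.schwarzian (x - θ) := by
  induction x using QuotientAddGroup.induction_on with | H x => ?_
  induction θ using QuotientAddGroup.induction_on with | H r => ?_
  exact (schwarzian_coe (φ := ψ.compSub r) (ψ.isDiffLift_lift.comp_sub_const r)
    (fun x => ψ.coe_lift (x - r)) x).trans (schwarzian_comp_sub_const ψ.lift r x)

theorem postcomp_coe (ψ : CircleDiff 3) (φ : CircleDiff 1) (x : ℝ) :
    (ψ.postcomp φ).toFun (x : UnitAddCircle) = ((ψ.lift ∘ φ.lift) x : ℝ) := by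
  change ψ.toFun (φ.toFun (x : UnitAddCircle)) = _
  rw [coe_lift, coe_lift, Function.comp_apply]

theorem deriv_postcomp (ψ : CircleDiff 3) (φ : CircleDiff 1) (x : UnitAddCircle) :
    (ψ.postcomp φ).deriv x = ψ.deriv (φ.toFun x) * φ.deriv x := by
  induction x using QuotientAddGroup.induction_on with | H x => ?_
  have hψ := ψ.isDiffLift_lift
  have hφ := φ.isDiffLift_lift
  change _ = ψ.deriv (φ.toFun (x : UnitAddCircle)) * _
  rw [φ.coe_lift]
  exact (deriv_coe ((hψ.of_le (by norm_num)).comp hφ) (postcomp_coe ψ φ) x).trans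
    ((hψ.hasDerivAt _).comp x (hφ.hasDerivAt x)).deriv

theorem postcomp_surjective (ψ : CircleDiff 3) : Function.Surjective ψ.postcomp := by
  intro χ
  obtain ⟨Θ, hΘ, hinv⟩ := ψ.isDiffLift_lift.exists_rightInverse
  refine ⟨ofLift (Θ ∘ χ.lift) ((hΘ.of_le (by norm_num)).comp χ.isDiffLift_lift), ?_⟩
  ext x
  induction x using QuotientAddGroup.induction_on with | H x => ?_
  change ψ.toFun ((Θ (χ.lift x) : ℝ) : UnitAddCircle) = χ.toFun (x : UnitAddCircle)
  rw [coe_lift, coe_lift, hinv]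

theorem integral_comp_mul_deriv {g : UnitAddCircle → ℝ} (hg : Continuous g) (φ : CircleDiff 1) :
    ∫ t, g (φ.toFun t) * φ.deriv t = ∫ x, g x := by
  have hφ := φ.isDiffLift_lift
  have hg' : Continuous fun x : ℝ => g x := hg.comp (AddCircle.continuous_mk' 1)
  have hsubst := intervalIntegral.integral_comp_mul_deriv (a := 0) (b := 1)
    (fun x _ => hφ.hasDerivAt x) (hφ.continuous_deriv le_rfl).continuousOn hg'
  rw [← UnitAddCircle.intervalIntegral_preimage 0, ← UnitAddCircle.intervalIntegral_preimage
    (φ.lift 0), zero_add, ← hφ.map_add_one, zero_add, ← hsubst]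
  exact intervalIntegral.integral_congr fun x _ => by
    simp only [coe_lift, Function.comp_apply, deriv_coe hφ φ.coe_lift]

end Basic

/-! ### Continuity in the `C¹` topology -/

theorem continuous_toFun_uncurry :
    Continuous fun p : CircleDiff 1 × UnitAddCircle => p.1.toFun p.2 := by
  have h : Continuous fun φ : CircleDiff 1 =>
      ((⟨φ.toFun, φ.continuous_toFun⟩, ⟨φ.deriv, φ.continuous_deriv⟩) :
        C(UnitAddCircle, UnitAddCircle) × C(UnitAddCircle, ℝ)) := continuous_induced_dom
  exact (continuous_eval (F := C(UnitAddCircle, UnitAddCircle))).comp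
    ((h.fst.comp continuous_fst).prodMk continuous_snd)

theorem continuous_deriv_uncurry :
    Continuous fun p : CircleDiff 1 × UnitAddCircle => p.1.deriv p.2 := by
  have h : Continuous fun φ : CircleDiff 1 =>
      ((⟨φ.toFun, φ.continuous_toFun⟩, ⟨φ.deriv, φ.continuous_deriv⟩) :
        C(UnitAddCircle, UnitAddCircle) × C(UnitAddCircle, ℝ)) := continuous_induced_dom
  exact (continuous_eval (F := C(UnitAddCircle, ℝ))).comp
    ((h.snd.comp continuous_fst).prodMk continuous_snd)

theorem continuous_postcomp (ψ : CircleDiff 3) : Continuous ψ.postcomp := by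
  let F : C(CircleDiff 1 × UnitAddCircle, UnitAddCircle) :=
    ⟨fun p => ψ.toFun (p.1.toFun p.2), ψ.continuous_toFun.comp continuous_toFun_uncurry⟩
  let G : C(CircleDiff 1 × UnitAddCircle, ℝ) :=
    ⟨fun p => ψ.deriv (p.1.toFun p.2) * p.1.deriv p.2,
      ((ψ.continuous_deriv_of_one_le (by norm_num)).comp continuous_toFun_uncurry).mul
        continuous_deriv_uncurry⟩
  refine continuous_induced_rng.2 ((F.curry.continuous.prodMk G.curry.continuous).congr fun φ => ?_)
  exact Prod.ext rfl (ContinuousMap.ext fun x => (deriv_postcomp ψ φ x).symm)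

end CircleDiff

theorem continuous_integral_of_compactSpace {X Y : Type*} [TopologicalSpace X] [TopologicalSpace Y]
    [CompactSpace Y] [MeasurableSpace Y] [OpensMeasurableSpace Y] {μ : Measure Y}
    [IsFiniteMeasure μ] {f : X → Y → ℝ} (hf : Continuous (Function.uncurry f)) :
    Continuous fun x => ∫ y, f x y ∂μ :=
  continuousOn_univ.1 (continuousOn_integral_of_compact_support isCompact_univ hf.continuousOn
    fun _ y _ hy => absurd (Set.mem_univ y) hy)

/-! ### Orbital measures and their partition function -/

namespace CircleDiff

/-- The integral `∫_𝕋 W(φ(τ)) φ'(τ)² dτ`: the energy density of `φ` integrated against a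
potential `W` along `φ`. Change of variables densities and energies are of this form. -/
noncomputable def action (W : UnitAddCircle → ℝ) (φ : CircleDiff 1) : ℝ :=
  ∫ t, W (φ.toFun t) * φ.deriv t ^ 2

variable {W V : UnitAddCircle → ℝ}

theorem integrable_action (hW : Continuous W) (φ : CircleDiff 1) :
    Integrable fun t => W (φ.toFun t) * φ.deriv t ^ 2 :=
  ((hW.comp φ.continuous_toFun).mul (φ.continuous_deriv.pow 2)).integrable_of_hasCompactSupport
    (HasCompactSupport.of_compactSpace _)

theorem action_add (hW : Continuous W) (hV : Continuous V) (φ : CircleDiff 1) :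
    action (fun x => W x + V x) φ = action W φ + action V φ := by
  simp only [action, add_mul]
  exact integral_add (integrable_action hW φ) (integrable_action hV φ)

theorem action_const_mul (c : ℝ) (W : UnitAddCircle → ℝ) (φ : CircleDiff 1) :
    action (fun x => c * W x) φ = c * action W φ := by
  simp only [action, mul_assoc, integral_const_mul]

theorem action_const (c : ℝ) (φ : CircleDiff 1) : action (fun _ => c) φ = c * φ.energy := by
  simp only [action, energy, integral_const_mul]

theorem action_const_sub (c : ℝ) (hV : Continuous V) (φ : CircleDiff 1) :
    action (fun x => c - V x) φ = c * φ.energy - action V φ := by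
  rw [← action_const]
  simp only [action, sub_mul]
  exact integral_sub (integrable_action continuous_const φ) (integrable_action hV φ)

theorem action_nonneg (hW : ∀ x, 0 ≤ W x) (φ : CircleDiff 1) : 0 ≤ action W φ :=
  integral_nonneg fun _ => mul_nonneg (hW _) (sq_nonneg _)

theorem energy_nonneg (φ : CircleDiff 1) : 0 ≤ φ.energy :=
  integral_nonneg fun _ => sq_nonneg _

theorem continuous_action_uncurry {X : Type*} [TopologicalSpace X] {W : X → UnitAddCircle → ℝ}
    (hW : Continuous (Function.uncurry W)) :
    Continuous fun p : X × CircleDiff 1 => action (W p.1) p.2 := by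
  have hev : Continuous fun q : (X × CircleDiff 1) × UnitAddCircle => (q.1.2, q.2) := by fun_prop
  exact continuous_integral_of_compactSpace <|
    (hW.comp (continuous_fst.fst.prodMk (continuous_toFun_uncurry.comp hev))).mul
      ((continuous_deriv_uncurry.comp hev).pow 2)

theorem continuous_action (hW : Continuous W) : Continuous (action W) :=
  (continuous_action_uncurry (W := fun _ : Unit => W) (hW.comp continuous_snd)).comp
    (Continuous.prodMk_right ())

theorem continuous_energy : Continuous energy :=
  (continuous_action (W := fun _ => 1) continuous_const).congr fun φ => by
    rw [action_const, one_mul]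

theorem measurable_exp_action (c : ℝ) (hW : Continuous W) :
    Measurable fun φ => ENNReal.ofReal (Real.exp (c * action W φ)) :=
  (Real.continuous_exp.comp (continuous_const.mul (continuous_action hW))).measurable.ennreal_ofReal

theorem measurable_exp_energy (c : ℝ) :
    Measurable fun φ : CircleDiff 1 => ENNReal.ofReal (Real.exp (c * φ.energy)) :=
  (Real.continuous_exp.comp (continuous_const.mul continuous_energy)).measurable.ennreal_ofReal

theorem energy_postcomp (ψ : CircleDiff 3) (φ : CircleDiff 1) :
    (ψ.postcomp φ).energy = action (fun x => ψ.deriv x ^ 2) φ := by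
  simp only [energy, action, deriv_postcomp, mul_pow]

end CircleDiff

section PartitionFunction

open CircleDiff

variable {σsq a a₀ : ℝ} {μ ν : Measure (CircleDiff 1)}

theorem orbitalDensity_eq_exp_action (σsq a : ℝ) (ψ : CircleDiff 3) (φ : CircleDiff 1) :
    orbitalDensity σsq a ψ φ = Real.exp (1 / σsq *
      (action ψ.schwarzian φ + 2 * a * ((ψ.postcomp φ).energy - φ.energy))) := by
  have hderiv : Continuous fun x => ψ.deriv x ^ 2 :=
    (ψ.continuous_deriv_of_one_le (by norm_num)).pow 2
  rw [energy_postcomp, sub_eq_add_neg, ← neg_one_mul φ.energy, ← action_const,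
    ← action_add hderiv continuous_const, ← action_const_mul,
    ← action_add ψ.continuous_schwarzian (by fun_prop)]
  rfl

theorem measurable_orbitalDensity (σsq a : ℝ) (ψ : CircleDiff 3) :
    Measurable fun φ => ENNReal.ofReal (orbitalDensity σsq a ψ φ) := by
  have hderiv : Continuous ψ.deriv := ψ.continuous_deriv_of_one_le (by norm_num)
  have hS := ψ.continuous_schwarzian
  exact measurable_exp_action (1 / σsq)
    (W := fun x => ψ.schwarzian x + 2 * a * (ψ.deriv x ^ 2 - 1)) (by fun_prop)

/-- The change of variables property of orbital measures, written as invariance under `ψ ∘ ·` after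
multiplication by the density, without the requirement that the measure be Radon. -/
def IsQuasiInvariant (σsq a : ℝ) (μ : Measure (CircleDiff 1)) : Prop :=
  ∀ ψ : CircleDiff 3,
    (μ.withDensity fun φ => ENNReal.ofReal (orbitalDensity σsq a ψ φ)).map ψ.postcomp = μ

/-- The total mass of the reweighted measure `exp {(2 a / σ²) ∫_𝕋 φ'(τ)² dτ} dν(φ)`, as a function
of `a = α²`. -/
noncomputable def partitionFunction (σsq : ℝ) (ν : Measure (CircleDiff 1)) (a : ℝ) : ℝ≥0∞ :=
  ∫⁻ φ, ENNReal.ofReal (Real.exp (2 * a / σsq * φ.energy)) ∂ν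

theorem IsOrbitalMeasure.isQuasiInvariant (hμ : IsOrbitalMeasure σsq a μ) :
    IsQuasiInvariant σsq a μ := by
  intro ψ
  have hψ := ψ.continuous_postcomp.measurable
  ext B hB
  rw [Measure.map_apply hψ hB, withDensity_apply _ (hψ hB), ← hμ.change_of_variables ψ _ (hψ hB),
    Set.image_preimage_eq _ ψ.postcomp_surjective]

theorem IsQuasiInvariant.lintegral_eq (hμ : IsQuasiInvariant σsq a μ) (ψ : CircleDiff 3)
    {F : CircleDiff 1 → ℝ≥0∞} (hF : Measurable F) :
    ∫⁻ φ, ENNReal.ofReal (orbitalDensity σsq a ψ φ) * F (ψ.postcomp φ) ∂μ = ∫⁻ φ, F φ ∂μ := by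
  have hψ := ψ.continuous_postcomp.measurable
  conv_rhs => rw [← hμ ψ]
  rw [lintegral_map hF hψ, lintegral_withDensity_eq_lintegral_mul _
    (measurable_orbitalDensity σsq a ψ) (g := fun φ => F (ψ.postcomp φ)) (hF.comp hψ)]
  simp only [Pi.mul_apply]

theorem IsQuasiInvariant.changeOfOrbit (hμ : IsQuasiInvariant σsq a₀ μ) (a : ℝ) :
    IsQuasiInvariant σsq a (changeOfOrbit σsq a₀ a μ) := by
  intro ψ
  have hψ := ψ.continuous_postcomp.measurable
  have hE := measurable_exp_energy (2 * (a - a₀) / σsq)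
  have hD := measurable_orbitalDensity σsq a ψ
  refine Measure.ext_of_lintegral _ fun F hF => ?_
  have hFψ : Measurable fun φ => F (ψ.postcomp φ) := hF.comp hψ
  rw [lintegral_map hF hψ, lintegral_withDensity_eq_lintegral_mul _ hD hFψ,
    _root_.changeOfOrbit, lintegral_withDensity_eq_lintegral_mul _ hE (hD.mul hFψ),
    lintegral_withDensity_eq_lintegral_mul _ hE hF, ← hμ.lintegral_eq ψ (hE.mul hF)]
  refine lintegral_congr fun φ => ?_
  simp only [Pi.mul_apply, ← mul_assoc, ← ENNReal.ofReal_mul,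
    orbitalDensity_eq_exp_action, Real.exp_nonneg, ← Real.exp_add]
  ring_nf

theorem changeOfOrbit_univ (σsq a₀ a : ℝ) (μ : Measure (CircleDiff 1)) :
    changeOfOrbit σsq a₀ a μ Set.univ
      = partitionFunction σsq (changeOfOrbit σsq a₀ 0 μ) a := by
  rw [partitionFunction, changeOfOrbit, changeOfOrbit, lintegral_withDensity_eq_lintegral_mul _
    (measurable_exp_energy _) (measurable_exp_energy _), withDensity_apply _ MeasurableSet.univ,
    Measure.restrict_univ]
  refine lintegral_congr fun φ => ?_
  rw [Pi.mul_apply, ← ENNReal.ofReal_mul (Real.exp_nonneg _), ← Real.exp_add]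
  ring_nf

theorem IsQuasiInvariant.partitionFunction_eq (hν : IsQuasiInvariant σsq 0 ν) (a : ℝ)
    (ψ : CircleDiff 3) :
    partitionFunction σsq ν a = ∫⁻ φ, ENNReal.ofReal (Real.exp
      (1 / σsq * action (fun x => ψ.schwarzian x + 2 * a * ψ.deriv x ^ 2) φ)) ∂ν := by
  have hderiv : Continuous ψ.deriv := ψ.continuous_deriv_of_one_le (by norm_num)
  rw [partitionFunction, ← hν.lintegral_eq ψ (measurable_exp_energy _)]
  refine lintegral_congr fun φ => ?_
  rw [orbitalDensity_eq_exp_action, ← ENNReal.ofReal_mul (Real.exp_nonneg _), ← Real.exp_add,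
    action_add ψ.continuous_schwarzian (by fun_prop), action_const_mul, energy_postcomp]
  ring_nf

theorem partitionFunction_mono (hσ : 0 < σsq) : Monotone (partitionFunction σsq ν) :=
  fun a b hab => lintegral_mono fun φ => ENNReal.ofReal_le_ofReal <| Real.exp_le_exp.2 <| by
    have := φ.energy_nonneg
    gcongr

theorem sFinite_of_partitionFunction_ne_top (h : partitionFunction σsq ν a ≠ ∞) : SFinite ν := by
  let w : CircleDiff 1 → ℝ≥0∞ := fun φ => ENNReal.ofReal (Real.exp (2 * a / σsq * φ.energy))
  have hw : Measurable w := measurable_exp_energy _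
  have : IsFiniteMeasure (ν.withDensity w) := isFiniteMeasure_withDensity h
  rw [← withDensity_inv_same (μ := ν) hw
    (ae_of_all _ fun φ => (ENNReal.ofReal_pos.2 (Real.exp_pos _)).ne')
    (ae_of_all _ fun φ => ENNReal.ofReal_ne_top)]
  infer_instance

end PartitionFunction

/-! ### Circle diffeomorphisms from Floquet solutions of Hill's equation -/

theorem schwarzian_eq_of_hasDerivAt {f g g' : ℝ → ℝ} (hf : ∀ x, deriv (deriv f) x / deriv f x = g x)
    (hg : ∀ x, HasDerivAt g (g' x) x) (x : ℝ) : schwarzian f x = g' x - 1 / 2 * g x ^ 2 := by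
  rw [schwarzian, funext hf, (hg x).deriv, hf]

theorem hasDerivAt_integral_add_one {f : ℝ → ℝ} (hf : Continuous f) (x : ℝ) :
    HasDerivAt (fun x => ∫ t in x..x + 1, f t) (f (x + 1) - f x) x := by
  have hi : ∀ a b, IntervalIntegrable f volume a b := hf.intervalIntegrable
  have hF : ∀ x, HasDerivAt (fun x => ∫ t in (0 : ℝ)..x, f t) (f x) x := fun x =>
    hf.integral_hasStrictDerivAt 0 x |>.hasDerivAt
  refine (((hF (x + 1)).comp_add_const x 1).sub (hF x)).congr_of_eventuallyEq ?_
  exact Eventually.of_forall fun x =>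
    (intervalIntegral.integral_interval_sub_left (hi _ _) (hi _ _)).symm

/-- The weight `∫_x^{x+1} y⁻²`; if `y` is multiplied by `e^l` under the unit translation, then
`-(log (floquetWeight y)) / (2 l)` commutes with that translation up to adding `1`. -/
noncomputable def floquetWeight (y : ℝ → ℝ) (x : ℝ) : ℝ := ∫ t in x..x + 1, (y t ^ 2)⁻¹

section Hill

variable {l : ℝ} {y y' q : ℝ → ℝ}

theorem floquetWeight_pos (hy : Continuous y) (hpos : ∀ x, 0 < y x) (x : ℝ) :
    0 < floquetWeight y x :=
  intervalIntegral.intervalIntegral_pos_of_pos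
    (((hy.pow 2).inv₀ fun x => (pow_pos (hpos x) 2).ne').intervalIntegrable _ _)
    (fun x => inv_pos.2 (pow_pos (hpos x) 2)) (lt_add_one x)

theorem inv_sq_add_one (hfloquet : ∀ x, y (x + 1) = Real.exp l * y x) (x : ℝ) :
    (y (x + 1) ^ 2)⁻¹ = Real.exp (-(2 * l)) * (y x ^ 2)⁻¹ := by
  rw [hfloquet, mul_pow, mul_inv, Real.exp_neg, two_mul, Real.exp_add, sq]

theorem floquetWeight_add_one (hfloquet : ∀ x, y (x + 1) = Real.exp l * y x) (x : ℝ) :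
    floquetWeight y (x + 1) = Real.exp (-(2 * l)) * floquetWeight y x := by
  rw [floquetWeight, ← intervalIntegral.integral_comp_add_right, floquetWeight,
    ← intervalIntegral.integral_const_mul]
  simp only [inv_sq_add_one hfloquet]

theorem hasDerivAt_floquetWeight (hy : Continuous y) (hpos : ∀ x, 0 < y x)
    (hfloquet : ∀ x, y (x + 1) = Real.exp l * y x) (x : ℝ) :
    HasDerivAt (floquetWeight y) (-((1 - Real.exp (-(2 * l))) * (y x ^ 2)⁻¹)) x := by
  refine (hasDerivAt_integral_add_one
    ((hy.pow 2).inv₀ fun x => (pow_pos (hpos x) 2).ne') x).congr_deriv ?_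
  simp only [Pi.inv_apply, Pi.pow_apply, inv_sq_add_one hfloquet]
  ring

/-- The lift `-(log ∫_x^{x+1} y⁻²) / (2 l)` attached to a positive Floquet solution `y` of Hill's
equation with multiplier `e^l`. -/
noncomputable def floquetLift (l : ℝ) (y : ℝ → ℝ) (x : ℝ) : ℝ :=
  -(Real.log (floquetWeight y x) / (2 * l))

theorem hasDerivAt_floquetLift (hy : Continuous y) (hpos : ∀ x, 0 < y x)
    (hfloquet : ∀ x, y (x + 1) = Real.exp l * y x) (x : ℝ) :
    HasDerivAt (floquetLift l y)
      ((1 - Real.exp (-(2 * l))) / (2 * l) * ((y x ^ 2)⁻¹ / floquetWeight y x)) x := by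
  refine ((((hasDerivAt_floquetWeight hy hpos hfloquet x).log
    (floquetWeight_pos hy hpos x).ne').div_const (2 * l)).neg).congr_deriv ?_
  ring

theorem one_sub_exp_neg_div_pos {x : ℝ} (hx : x ≠ 0) : 0 < (1 - Real.exp (-x)) / x := by
  rcases hx.lt_or_gt with h | h
  · exact div_pos_of_neg_of_neg (by simpa using h) h
  · exact div_pos (by simpa using h) h

theorem deriv_floquetLift_pos (hl : l ≠ 0) (hy : Continuous y) (hpos : ∀ x, 0 < y x)
    (hfloquet : ∀ x, y (x + 1) = Real.exp l * y x) (x : ℝ) : 0 < deriv (floquetLift l y) x := by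
  rw [(hasDerivAt_floquetLift hy hpos hfloquet x).deriv]
  have := floquetWeight_pos hy hpos x
  have := one_sub_exp_neg_div_pos (mul_ne_zero two_ne_zero hl)
  have := hpos x
  positivity

theorem isDiffLift_floquetLift (hl : l ≠ 0) (hy : ContDiff ℝ 2 y) (hpos : ∀ x, 0 < y x)
    (hfloquet : ∀ x, y (x + 1) = Real.exp l * y x) : IsDiffLift 3 (floquetLift l y) where
  contDiff := by
    have hder := hasDerivAt_floquetWeight hy.continuous hpos hfloquet
    have hweight : ContDiff ℝ 3 (floquetWeight y) := by
      rw [show (3 : WithTop ℕ∞) = 2 + 1 by norm_num, contDiff_succ_iff_deriv]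
      refine ⟨fun x => (hder x).differentiableAt, by simp, ?_⟩
      rw [funext fun x => (hder x).deriv]
      exact (contDiff_const.mul ((hy.pow 2).inv fun x => (pow_pos (hpos x) 2).ne')).neg
    exact ((hweight.log fun x => (floquetWeight_pos hy.continuous hpos x).ne').div_const _).neg
  deriv_pos := deriv_floquetLift_pos hl hy.continuous hpos hfloquet
  map_add_one x := by
    rw [floquetLift, floquetLift, floquetWeight_add_one hfloquet, Real.log_mul (Real.exp_ne_zero _)
      (floquetWeight_pos hy.continuous hpos x).ne', Real.log_exp]
    field_simp
    ring

theorem schwarzian_floquetLift (hl : l ≠ 0) (hpos : ∀ x, 0 < y x)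
    (hfloquet : ∀ x, y (x + 1) = Real.exp l * y x) (hy : ∀ x, HasDerivAt y (y' x) x)
    (hy' : ∀ x, HasDerivAt y' (q x * y x) x) (x : ℝ) :
    schwarzian (floquetLift l y) x = -2 * q x + 2 * l ^ 2 * deriv (floquetLift l y) x ^ 2 := by
  have hyc : Continuous y := continuous_iff_continuousAt.2 fun x => (hy x).continuousAt
  have hΨ := hasDerivAt_floquetLift hyc hpos hfloquet
  -- Logarithmic differentiation of `Ψ' ∝ y⁻² / I`, where `I' = -2 l Ψ' I`.
  have hΨ'' : ∀ x, HasDerivAt (deriv (floquetLift l y)) (deriv (floquetLift l y) x *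
      (-2 * (y' x / y x) + 2 * l * deriv (floquetLift l y) x)) x := fun x => by
    have hI := (floquetWeight_pos hyc hpos x).ne'
    have hyx := (hpos x).ne'
    rw [funext fun x => (hΨ x).deriv]
    refine ((((hy x).pow 2).inv (pow_ne_zero 2 hyx)).div
      (hasDerivAt_floquetWeight hyc hpos hfloquet x) hI |>.const_mul _).congr_deriv ?_
    simp only [Pi.inv_apply, Pi.pow_apply]
    field_simp
    ring
  have hlog : ∀ x, HasDerivAt (fun x => -2 * (y' x / y x) + 2 * l * deriv (floquetLift l y) x)
      (-2 * (q x - (y' x / y x) ^ 2) + 2 * l * (deriv (floquetLift l y) x *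
        (-2 * (y' x / y x) + 2 * l * deriv (floquetLift l y) x))) x := fun x => by
    have hyx := (hpos x).ne'
    refine ((((hy' x).div (hy x) hyx).const_mul (-2)).add
      ((hΨ'' x).const_mul (2 * l))).congr_deriv ?_
    field_simp
  rw [schwarzian_eq_of_hasDerivAt
    (fun x => by rw [(hΨ'' x).deriv,
      mul_div_cancel_left₀ _ (deriv_floquetLift_pos hl hyc hpos hfloquet x).ne']) hlog]
  ring

end Hill

theorem exists_schwarzian_sub_eq_hill {l : ℝ} {y y' : ℝ → ℝ} {q : UnitAddCircle → ℝ} (hl : l ≠ 0)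
    (hpos : ∀ x, 0 < y x) (hfloquet : ∀ x, y (x + 1) = Real.exp l * y x) (hq : Continuous q)
    (hy : ∀ x, HasDerivAt y (y' x) x) (hy' : ∀ x : ℝ, HasDerivAt y' (q x * y x) x) :
    ∃ ψ : CircleDiff 3, ∀ x, ψ.schwarzian x - 2 * l ^ 2 * ψ.deriv x ^ 2 = -2 * q x := by
  have hyc : Continuous y := continuous_iff_continuousAt.2 fun x => (hy x).continuousAt
  have hyC2 : ContDiff ℝ 2 y := by
    rw [show (2 : WithTop ℕ∞) = 1 + 1 by norm_num, contDiff_succ_iff_deriv,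
      funext fun x => (hy x).deriv, contDiff_one_iff_deriv, funext fun x => (hy' x).deriv]
    exact ⟨fun x => (hy x).differentiableAt, by simp, fun x => (hy' x).differentiableAt,
      (hq.comp (AddCircle.continuous_mk' 1)).mul hyc⟩
  have hlift := isDiffLift_floquetLift hl hyC2 hpos hfloquet
  refine ⟨CircleDiff.ofLift _ hlift, fun x => ?_⟩
  induction x using QuotientAddGroup.induction_on with | H x => ?_
  have hS := CircleDiff.schwarzian_coe (φ := CircleDiff.ofLift _ hlift) hlift (fun _ => rfl) x
  have hD := CircleDiff.deriv_coe (φ := CircleDiff.ofLift _ hlift) hlift (fun _ => rfl) x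
  have := schwarzian_floquetLift hl hpos hfloquet hy hy' x
  rw [← hS, ← hD] at this
  exact sub_eq_iff_eq_add.2 this

/-! ### The kink potential -/

/-- The kernel on `(0, 1]` of the inverse of `d/dx + m` on `1`-periodic functions. -/
noncomputable def resolventKernel (m v : ℝ) : ℝ := Real.exp (-(m * v)) / (1 - Real.exp (-m))

/-- The `1`-periodic solution of `P' = -m P + ρ`. -/
noncomputable def periodicResolvent (m : ℝ) (ρ : UnitAddCircle → ℝ) (x : ℝ) : ℝ :=
  ∫ v in (0 : ℝ)..1, resolventKernel m v * ρ (x - v : ℝ)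

section PeriodicResolvent

variable {m : ℝ} {ρ : UnitAddCircle → ℝ}

theorem one_sub_exp_neg_pos (hm : 0 < m) : 0 < 1 - Real.exp (-m) := by simpa using hm

theorem one_sub_exp_neg_ne_zero (hm : m ≠ 0) : 1 - Real.exp (-m) ≠ 0 :=
  sub_ne_zero.2 fun h => hm (neg_eq_zero.1 (Real.exp_eq_one_iff _ |>.1 h.symm))

theorem continuous_resolventKernel (m : ℝ) : Continuous (resolventKernel m) := by
  unfold resolventKernel
  fun_prop

theorem resolventKernel_one (hm : m ≠ 0) : resolventKernel m 1 = resolventKernel m 0 - 1 := by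
  have := one_sub_exp_neg_ne_zero hm
  simp only [resolventKernel, mul_one, mul_zero, neg_zero, Real.exp_zero]
  field_simp
  ring

theorem resolventKernel_lt {n v : ℝ} (hm : 0 < m) (hmn : m < n) (hv : 0 ≤ v) :
    resolventKernel n v < resolventKernel m v := by
  have hexp : Real.exp (-n) < Real.exp (-m) := Real.exp_lt_exp.2 (neg_lt_neg hmn)
  exact div_lt_div₀' (Real.exp_le_exp.2 (by gcongr)) (sub_lt_sub_left hexp 1) (Real.exp_pos _)
    (one_sub_exp_neg_pos hm)

theorem periodicResolvent_add_one (m : ℝ) (ρ : UnitAddCircle → ℝ) (x : ℝ) :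
    periodicResolvent m ρ (x + 1) = periodicResolvent m ρ x := by
  simp only [periodicResolvent, add_sub_right_comm, AddCircle.coe_add, AddCircle.coe_period,
    add_zero]

theorem periodicResolvent_eq (m : ℝ) (ρ : UnitAddCircle → ℝ) (x : ℝ) :
    periodicResolvent m ρ x = Real.exp (-(m * x)) / (1 - Real.exp (-m)) *
      ∫ t in (x - 1)..(x - 1 + 1), Real.exp (m * t) * ρ t := by
  have hreflect := intervalIntegral.integral_comp_sub_left (a := 0) (b := 1)
    (fun t => resolventKernel m (x - t) * ρ t) x
  simp only [sub_sub_cancel, sub_zero] at hreflect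
  rw [periodicResolvent, hreflect, sub_add_cancel, ← intervalIntegral.integral_const_mul]
  refine intervalIntegral.integral_congr fun t _ => ?_
  simp only [resolventKernel, mul_sub, neg_sub, sub_eq_neg_add (m * t), Real.exp_add]
  ring

theorem hasDerivAt_periodicResolvent (hm : m ≠ 0) (hρ : Continuous ρ) (x : ℝ) :
    HasDerivAt (periodicResolvent m ρ) (-(m * periodicResolvent m ρ x) + ρ x) x := by
  have hcont : Continuous fun t : ℝ => Real.exp (m * t) * ρ t :=
    (by fun_prop : Continuous fun t => Real.exp (m * t)).mul
      (hρ.comp (AddCircle.continuous_mk' 1))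
  have hexp : HasDerivAt (fun x => Real.exp (-(m * x))) (Real.exp (-(m * x)) * -(m * 1)) x :=
    ((hasDerivAt_id x).const_mul m).neg.exp
  have hprod := (hexp.div_const (1 - Real.exp (-m))).mul
    ((hasDerivAt_integral_add_one hcont (x - 1)).comp_sub_const x 1)
  have hperiod : ρ ((x - 1 : ℝ) : UnitAddCircle) = ρ x := by
    rw [AddCircle.coe_sub, AddCircle.coe_period, sub_zero]
  have hne := one_sub_exp_neg_ne_zero hm
  rw [funext (periodicResolvent_eq m ρ)]
  refine hprod.congr_deriv ?_
  have hcancel : Real.exp (-(m * x)) * (Real.exp (m * x) * ρ x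
      - Real.exp (m * (x - 1)) * ρ x) = (1 - Real.exp (-m)) * ρ x := by
    rw [show m * (x - 1) = m * x + -m by ring, Real.exp_add, Real.exp_neg (m * x)]
    field_simp
  simp only [sub_add_cancel, hperiod]
  rw [div_mul_eq_mul_div _ _ (_ - _), hcancel, mul_div_cancel_left₀ _ hne]
  ring

end PeriodicResolvent

/-- The difference of the resolvent kernels at `l - b` and `l + b`, as a function on the circle;
unlike the two kernels it is continuous at `0`. -/
noncomputable def kinkKernel (l b : ℝ) : UnitAddCircle → ℝ :=
  AddCircle.liftIoc 1 0 fun v => resolventKernel (l - b) v - resolventKernel (l + b) v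

/-- The convolution of `ρ` with `kinkKernel l b`. -/
noncomputable def kinkProfile (l b : ℝ) (ρ : UnitAddCircle → ℝ) (x : UnitAddCircle) : ℝ :=
  ∫ v, ρ v * kinkKernel l b (x - v)

/-- The potential `4 b ρ / p`, where `p` is the kink profile. For `ρ` close to the Dirac mass at `0`
this is close to a multiple of that Dirac mass. -/
noncomputable def kinkPotential (l b : ℝ) (ρ : UnitAddCircle → ℝ) (x : UnitAddCircle) : ℝ :=
  4 * b * (ρ x / kinkProfile l b ρ x)

section Kink

variable {l b : ℝ} {ρ : UnitAddCircle → ℝ}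

theorem continuous_kinkKernel (hb : l - b ≠ 0) (hb' : l + b ≠ 0) : Continuous (kinkKernel l b) := by
  refine AddCircle.liftIoc_continuous ?_
    ((continuous_resolventKernel _).sub (continuous_resolventKernel _)).continuousOn
  rw [zero_add, resolventKernel_one hb, resolventKernel_one hb']
  ring

theorem kinkKernel_pos (hb : 0 < b) (hbl : b < l) (x : UnitAddCircle) : 0 < kinkKernel l b x :=
  sub_pos.2 <| resolventKernel_lt (by linarith) (by linarith)
    (AddCircle.equivIoc 1 0 x).2.1.le

theorem kinkKernel_zero (hb : 0 < b) (hbl : b < l) :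
    kinkKernel l b 0 = Real.sinh b / (Real.cosh l - Real.cosh b) := by
  have hm := one_sub_exp_neg_pos (sub_pos.2 hbl)
  have hn := one_sub_exp_neg_pos (add_pos (hb.trans hbl) hb)
  have hcosh : Real.cosh b < Real.cosh l := by
    rw [Real.cosh_lt_cosh, abs_of_pos hb, abs_of_pos (hb.trans hbl)]
    exact hbl
  have hone : kinkKernel l b 0 = resolventKernel (l - b) 1 - resolventKernel (l + b) 1 := by
    rw [← AddCircle.coe_period, kinkKernel, AddCircle.liftIoc_coe_apply (by simp)]
  rw [hone, resolventKernel, resolventKernel, mul_one, mul_one, div_sub_div _ _ hm.ne' hn.ne',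
    div_eq_div_iff (by positivity) (sub_pos.2 hcosh).ne', Real.sinh_eq, Real.cosh_eq, Real.cosh_eq]
  rw [neg_sub, Real.exp_sub, neg_add, Real.exp_add, Real.exp_neg, Real.exp_neg]
  field_simp
  ring

theorem kinkProfile_coe (hρ : Continuous ρ) (x : ℝ) :
    kinkProfile l b ρ x = periodicResolvent (l - b) ρ x - periodicResolvent (l + b) ρ x := by
  have hρ' : Continuous fun v : ℝ => ρ (x - v : ℝ) :=
    hρ.comp ((AddCircle.continuous_mk' 1).comp (by fun_prop))
  have hi : ∀ m, IntervalIntegrable (fun v => resolventKernel m v * ρ (x - v : ℝ)) volume 0 1 :=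
    fun m => ((continuous_resolventKernel m).mul hρ').intervalIntegrable _ _
  rw [kinkProfile, ← integral_sub_left_eq_self _ volume (x : UnitAddCircle),
    ← UnitAddCircle.intervalIntegral_preimage 0, zero_add, periodicResolvent, periodicResolvent,
    ← intervalIntegral.integral_sub (hi _) (hi _)]
  refine intervalIntegral.integral_congr_Ioo_of_le zero_le_one fun v hv => ?_
  simp only [sub_sub_cancel]
  rw [kinkKernel, AddCircle.liftIoc_coe_apply ⟨hv.1, by simpa using hv.2.le⟩, AddCircle.coe_sub]
  ring

theorem continuous_kinkProfile (hb : l - b ≠ 0) (hb' : l + b ≠ 0) (hρ : Continuous ρ) :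
    Continuous (kinkProfile l b ρ) :=
  continuous_integral_of_compactSpace <| (hρ.comp continuous_snd).mul
    ((continuous_kinkKernel hb hb').comp (continuous_fst.sub continuous_snd))

theorem kinkProfile_pos (hb : 0 < b) (hbl : b < l) (hρ : Continuous ρ) (hρ0 : ∀ x, 0 ≤ ρ x)
    {x₀ : UnitAddCircle} (hx₀ : ρ x₀ ≠ 0) (x : UnitAddCircle) : 0 < kinkProfile l b ρ x := by
  have hK := continuous_kinkKernel (l := l) (b := b) (by linarith) (by linarith)
  exact (hρ.mul (hK.comp (continuous_const.sub
    continuous_id))).integral_pos_of_hasCompactSupport_nonneg_nonzero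
    (HasCompactSupport.of_compactSpace _)
    (fun v => mul_nonneg (hρ0 v) (kinkKernel_pos hb hbl _).le)
    (mul_ne_zero hx₀ (kinkKernel_pos hb hbl _).ne')

theorem continuous_kinkPotential (hb : 0 < b) (hbl : b < l) (hρ : Continuous ρ)
    (hρ0 : ∀ x, 0 ≤ ρ x) {x₀ : UnitAddCircle} (hx₀ : ρ x₀ ≠ 0) :
    Continuous (kinkPotential l b ρ) :=
  continuous_const.mul (hρ.div (continuous_kinkProfile (by linarith) (by linarith) hρ) fun x =>
    (kinkProfile_pos hb hbl hρ hρ0 hx₀ x).ne')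

theorem kinkPotential_nonneg (hb : 0 < b) (hbl : b < l) (hρ0 : ∀ x, 0 ≤ ρ x) (x : UnitAddCircle) :
    0 ≤ kinkPotential l b ρ x :=
  mul_nonneg (by positivity) (div_nonneg (hρ0 x) (integral_nonneg fun v =>
    mul_nonneg (hρ0 v) (kinkKernel_pos hb hbl _).le))

theorem exists_schwarzian_sub_eq_kink (hb : 0 < b) (hbl : b < l) (hρ : Continuous ρ)
    (hρ0 : ∀ x, 0 ≤ ρ x) {x₀ : UnitAddCircle} (hx₀ : ρ x₀ ≠ 0) :
    ∃ ψ : CircleDiff 3, ∀ x, ψ.schwarzian x - 2 * l ^ 2 * ψ.deriv x ^ 2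
      = -(2 * b ^ 2) - kinkPotential l b ρ x := by
  have hm : l - b ≠ 0 := by linarith
  have hn : l + b ≠ 0 := by linarith
  let P := periodicResolvent (l - b) ρ
  let Q := periodicResolvent (l + b) ρ
  have hpos : ∀ x : ℝ, 0 < P x - Q x := fun x =>
    kinkProfile_coe hρ x ▸ kinkProfile_pos hb hbl hρ hρ0 hx₀ x
  have hP := hasDerivAt_periodicResolvent hm hρ
  have hQ := hasDerivAt_periodicResolvent hn hρ
  have hexp : ∀ x, HasDerivAt (fun x => Real.exp (l * x)) (Real.exp (l * x) * (l * 1)) x :=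
    fun x => ((hasDerivAt_id x).const_mul l).exp
  -- `y = e^{l x} (P - Q)` satisfies `y' = b e^{l x} (P + Q)` and `y'' = b² y + 2 b e^{l x} ρ`.
  obtain ⟨ψ, hψ⟩ := exists_schwarzian_sub_eq_hill (hb.trans hbl).ne'
    (y := fun x => Real.exp (l * x) * (P x - Q x))
    (y' := fun x => Real.exp (l * x) * (b * (P x + Q x)))
    (q := fun x => b ^ 2 + kinkPotential l b ρ x / 2)
    (fun x => mul_pos (Real.exp_pos _) (hpos x))
    (fun x => by
      simp only [P, Q, periodicResolvent_add_one, mul_add, mul_one, Real.exp_add]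
      ring)
    (continuous_const.add ((continuous_kinkPotential hb hbl hρ hρ0 hx₀).div_const 2))
    (fun x => ((hexp x).mul ((hP x).sub (hQ x))).congr_deriv (by
      simp only [Pi.sub_apply, P, Q]
      ring))
    (fun x => ((hexp x).mul (((hP x).add (hQ x)).const_mul b)).congr_deriv (by
      have := (hpos x).ne'
      rw [kinkPotential, kinkProfile_coe hρ]
      simp only [Pi.add_apply, P, Q] at this ⊢
      field_simp
      ring))
  exact ⟨ψ, fun x => (hψ x).trans (by ring)⟩

end Kink

/-! ### Concentration of the kink potential -/

/-- A continuous approximate identity on the circle: the normalized tent of half-width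
`1 / (n + 1)` at `0`. -/
noncomputable def circleBump (n : ℕ) (x : UnitAddCircle) : ℝ :=
  max 0 (((n : ℝ) + 1)⁻¹ - ‖x‖) / ∫ y : UnitAddCircle, max 0 (((n : ℝ) + 1)⁻¹ - ‖y‖)

theorem integral_tent_pos {r : ℝ} (hr : 0 < r) : 0 < ∫ y : UnitAddCircle, max 0 (r - ‖y‖) := by
  have hcont : Continuous fun y : UnitAddCircle => max 0 (r - ‖y‖) := by fun_prop
  refine hcont.integral_pos_of_hasCompactSupport_nonneg_nonzero (x := 0)
    (HasCompactSupport.of_compactSpace _) (fun y => le_max_left _ _) ?_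
  simp [hr.le, hr.ne']

section CircleBump

variable (n : ℕ)

theorem continuous_circleBump : Continuous (circleBump n) := by
  unfold circleBump
  fun_prop

theorem circleBump_nonneg (x : UnitAddCircle) : 0 ≤ circleBump n x :=
  div_nonneg (le_max_left _ _) (integral_tent_pos (by positivity)).le

theorem circleBump_zero_ne_zero : circleBump n 0 ≠ 0 := by
  have hr : (0 : ℝ) < ((n : ℝ) + 1)⁻¹ := by positivity
  refine div_ne_zero ?_ (integral_tent_pos hr).ne'
  rw [norm_zero, sub_zero, max_eq_right hr.le]
  exact hr.ne'

theorem integral_circleBump : ∫ x, circleBump n x = 1 := by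
  simp only [circleBump, integral_div]
  exact div_self (integral_tent_pos (by positivity)).ne'

theorem support_circleBump_subset :
    Function.support (circleBump n) ⊆ Metric.ball 0 ((n : ℝ) + 1)⁻¹ := by
  refine fun x => not_imp_comm.1 fun hx => ?_
  rw [mem_ball_zero_iff, not_lt] at hx
  rw [circleBump, max_eq_left (sub_nonpos.2 hx), zero_div]

end CircleBump

theorem tendsto_support_circleBump :
    Tendsto (fun n => Function.support (circleBump n)) atTop (𝓝 0).smallSets := by
  refine tendsto_smallSets_iff.2 fun s hs => ?_
  obtain ⟨ε, hε, hball⟩ := Metric.mem_nhds_iff.1 hs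
  have hinv : Tendsto (fun n : ℕ => ((n : ℝ) + 1)⁻¹) atTop (𝓝 0) := by
    simpa only [one_div] using tendsto_one_div_add_atTop_nhds_zero_nat (𝕜 := ℝ)
  filter_upwards [hinv.eventually_le_const hε] with n hn
  exact (support_circleBump_subset n).trans ((Metric.ball_subset_ball hn).trans hball)

theorem tendsto_integral_circleBump_mul {ι : Type*} {L : Filter ι} {k : ι → ℕ}
    (hk : Tendsto k L atTop) {g : ι → UnitAddCircle → ℝ} (hg : ∀ i, Continuous (g i)) {z : ℝ}
    (hz : Tendsto (Function.uncurry g) (L ×ˢ 𝓝 0) (𝓝 z)) :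
    Tendsto (fun i => ∫ v, circleBump (k i) v * g i v) L (𝓝 z) := by
  have hneg : Tendsto (fun v : UnitAddCircle => -v) (𝓝 0) (𝓝 0) := by
    simpa only [neg_zero] using (continuous_neg (G := UnitAddCircle)).tendsto 0
  have h := convolution_tendsto_right (μ := volume) (φ := fun i => circleBump (k i))
    (g := fun i v => g i (-v)) (k := fun _ => 0)
    (.of_forall fun i => circleBump_nonneg (k i)) (.of_forall fun i => integral_circleBump (k i))
    (tendsto_support_circleBump.comp hk)
    (.of_forall fun i => ((hg i).comp continuous_neg).aestronglyMeasurable)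
    (hz.comp (tendsto_fst.prodMk (hneg.comp tendsto_snd))) tendsto_const_nhds
  simpa only [convolution_def, ContinuousLinearMap.lsmul_apply, smul_eq_mul, zero_sub, neg_neg]
    using h

theorem tendsto_kinkProfile_circleBump {l b : ℝ} (hm : l - b ≠ 0) (hn : l + b ≠ 0) :
    Tendsto (fun p : ℕ × UnitAddCircle => kinkProfile l b (circleBump p.1) p.2)
      (atTop ×ˢ 𝓝 0) (𝓝 (kinkKernel l b 0)) := by
  have hK := continuous_kinkKernel hm hn
  refine tendsto_integral_circleBump_mul (g := fun p v => kinkKernel l b (p.2 - v)) tendsto_fst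
    (fun p => hK.comp (continuous_const.sub continuous_id)) ?_
  have hsub : Tendsto (fun q : (ℕ × UnitAddCircle) × UnitAddCircle => q.1.2 - q.2)
      ((atTop ×ˢ 𝓝 0) ×ˢ 𝓝 0) (𝓝 0) := by
    simpa only [sub_zero, Function.comp_apply] using
      ((tendsto_snd (f := atTop (α := ℕ))).comp tendsto_fst).sub
        (tendsto_snd (f := atTop ×ˢ 𝓝 (0 : UnitAddCircle)) (g := 𝓝 (0 : UnitAddCircle)))
  exact (hK.tendsto 0).comp hsub

namespace CircleDiff

theorem exists_action_eq_integral (φ : CircleDiff 1) :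
    ∃ D : UnitAddCircle → ℝ, Continuous D ∧ (∀ t, D (φ.toFun t) = φ.deriv t) ∧
      ∀ W, Continuous W → action W φ = ∫ x, W x * D x := by
  let e := Equiv.ofBijective φ.toFun ⟨φ.injective_toFun, φ.surjective_toFun⟩
  let h := Continuous.homeoOfEquivCompactToT2 (f := e) φ.continuous_toFun
  have hD : Continuous (φ.deriv ∘ h.symm) := φ.continuous_deriv.comp h.symm.continuous
  have hDφ : ∀ t, (φ.deriv ∘ h.symm) (φ.toFun t) = φ.deriv t := fun t =>
    congrArg φ.deriv (h.symm_apply_apply t)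
  refine ⟨_, hD, hDφ, fun W hW => ?_⟩
  refine Eq.trans ?_ (integral_comp_mul_deriv (hW.mul hD) φ)
  simp only [action, Pi.mul_apply, hDφ, pow_two, mul_assoc]

theorem tendsto_action_kinkPotential {l b : ℝ} (hb : 0 < b) (hbl : b < l) (φ : CircleDiff 1)
    (t : UnitAddCircle) :
    Tendsto (fun n => action (fun x => kinkPotential l b (circleBump n) (x - φ.toFun t)) φ) atTop
      (𝓝 (4 * b * (Real.cosh l - Real.cosh b) / Real.sinh b * φ.deriv t)) := by
  obtain ⟨D, hD, hDφ, haction⟩ := φ.exists_action_eq_integral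
  have hm : l - b ≠ 0 := by linarith
  have hn : l + b ≠ 0 := by linarith
  have hD' : Continuous fun u => D (u + φ.toFun t) := hD.comp (continuous_add_const _)
  have hp := fun n => continuous_kinkProfile hm hn (continuous_circleBump n)
  have hp0 := fun n => kinkProfile_pos hb hbl (continuous_circleBump n) (circleBump_nonneg n)
    (circleBump_zero_ne_zero n)
  have hV := fun n => continuous_kinkPotential hb hbl (continuous_circleBump n)
    (circleBump_nonneg n) (circleBump_zero_ne_zero n)
  let g : ℕ → UnitAddCircle → ℝ := fun n u =>
    4 * b / kinkProfile l b (circleBump n) u * D (u + φ.toFun t)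
  have hg : Tendsto (Function.uncurry g) (atTop ×ˢ 𝓝 0)
      (𝓝 (4 * b / kinkKernel l b 0 * D (0 + φ.toFun t))) :=
    (tendsto_const_nhds.div (tendsto_kinkProfile_circleBump hm hn)
      (kinkKernel_pos hb hbl 0).ne').mul ((hD'.tendsto 0).comp tendsto_snd)
  have hlim := tendsto_integral_circleBump_mul tendsto_id (g := g) (fun n =>
    (continuous_const.div (hp n) fun u => (hp0 n u).ne').mul hD') hg
  rw [kinkKernel_zero hb hbl, zero_add, hDφ, div_div_eq_mul_div] at hlim
  refine hlim.congr fun n => ?_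
  rw [haction (fun x => kinkPotential l b (circleBump n) (x - φ.toFun t))
      ((hV n).comp (continuous_sub_right _)),
    ← integral_sub_right_eq_self _ (φ.toFun t)]
  refine integral_congr_ae (ae_of_all _ fun u => ?_)
  simp only [id_eq, sub_add_cancel, kinkPotential, g]
  ring

end CircleDiff

/-! ### Averaging over rotations -/

section Averaging

open CircleDiff

variable {σsq b l : ℝ} {ν : Measure (CircleDiff 1)}

theorem CircleDiff.lintegral_comp_mul_deriv {g : UnitAddCircle → ℝ} (hg : Continuous g)
    (hg0 : ∀ x, 0 ≤ g x) (φ : CircleDiff 1) :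
    ∫⁻ t, ENNReal.ofReal (g (φ.toFun t) * φ.deriv t) = ∫⁻ x, ENNReal.ofReal (g x) := by
  have hint : Integrable fun t => g (φ.toFun t) * φ.deriv t :=
    ((hg.comp φ.continuous_toFun).mul φ.continuous_deriv).integrable_of_hasCompactSupport
      (HasCompactSupport.of_compactSpace _)
  rw [← ofReal_integral_eq_lintegral_ofReal hint
      (ae_of_all _ fun t => mul_nonneg (hg0 _) (φ.deriv_pos t).le),
    ← ofReal_integral_eq_lintegral_ofReal (hg.integrable_of_hasCompactSupport
      (HasCompactSupport.of_compactSpace _)) (ae_of_all _ hg0), integral_comp_mul_deriv hg]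

theorem continuous_exp_action_sub {W : UnitAddCircle → ℝ} (c : ℝ) (hW : Continuous W) :
    Continuous fun p : CircleDiff 1 × UnitAddCircle =>
      Real.exp (c * action (fun x => W (x - p.2)) p.1) :=
  Real.continuous_exp.comp (continuous_const.mul ((continuous_action_uncurry
    (W := fun θ x => W (x - θ)) (hW.comp (continuous_snd.sub continuous_fst))).comp
      continuous_swap))

theorem measurable_exp_action_sub_mul_deriv {W : UnitAddCircle → ℝ} (c : ℝ) (hW : Continuous W) :
    Measurable fun p : CircleDiff 1 × UnitAddCircle => ENNReal.ofReal
      (Real.exp (c * action (fun x => W (x - p.1.toFun p.2)) p.1) * p.1.deriv p.2) :=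
  (((continuous_exp_action_sub c hW).comp (continuous_fst.prodMk continuous_toFun_uncurry)).mul
    continuous_deriv_uncurry).measurable.ennreal_ofReal

theorem IsQuasiInvariant.partitionFunction_eq_lintegral_prod [SFinite ν]
    (hν : IsQuasiInvariant σsq 0 ν) (a : ℝ) {W : UnitAddCircle → ℝ} (ψ : CircleDiff 3)
    (hψ : ∀ x, ψ.schwarzian x + 2 * a * ψ.deriv x ^ 2 = W x) :
    partitionFunction σsq ν a = ∫⁻ p : CircleDiff 1 × UnitAddCircle, ENNReal.ofReal
      (Real.exp (1 / σsq * action (fun x => W (x - p.1.toFun p.2)) p.1) * p.1.deriv p.2)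
        ∂ν.prod volume := by
  have hW : Continuous W := by
    have hderiv : Continuous ψ.deriv := ψ.continuous_deriv_of_one_le (by norm_num)
    rw [← funext hψ]
    exact ψ.continuous_schwarzian.add (by fun_prop)
  have hweight := continuous_exp_action_sub (1 / σsq) hW
  have hrot : ∀ θ, partitionFunction σsq ν a = ∫⁻ φ, ENNReal.ofReal
      (Real.exp (1 / σsq * action (fun x => W (x - θ)) φ)) ∂ν := by
    intro θ
    rw [hν.partitionFunction_eq a (ψ.compSub θ)]
    simp only [schwarzian_compSub, deriv_compSub, hψ]
  calc partitionFunction σsq ν a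
      = ∫⁻ θ : UnitAddCircle, ∫⁻ φ, ENNReal.ofReal
          (Real.exp (1 / σsq * action (fun x => W (x - θ)) φ)) ∂ν := by
        simp only [← hrot, lintegral_const, UnitAddCircle.measure_univ, mul_one]
    _ = ∫⁻ φ, ∫⁻ θ : UnitAddCircle, ENNReal.ofReal
          (Real.exp (1 / σsq * action (fun x => W (x - θ)) φ)) ∂volume ∂ν :=
        lintegral_lintegral_swap
          (hweight.comp continuous_swap).measurable.ennreal_ofReal.aemeasurable
    _ = _ := by
        rw [lintegral_prod _ (measurable_exp_action_sub_mul_deriv _ hW).aemeasurable]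
        exact lintegral_congr fun φ => (φ.lintegral_comp_mul_deriv
          (hweight.comp (Continuous.prodMk_right φ)) fun _ => Real.exp_nonneg _).symm

theorem lintegral_exp_energy_mul_deriv [SFinite ν] (c : ℝ) :
    ∫⁻ p : CircleDiff 1 × UnitAddCircle,
        ENNReal.ofReal (Real.exp (c * p.1.energy) * p.1.deriv p.2) ∂ν.prod volume
      = ∫⁻ φ, ENNReal.ofReal (Real.exp (c * φ.energy)) ∂ν := by
  have hmeas : Measurable fun p : CircleDiff 1 × UnitAddCircle =>
      ENNReal.ofReal (Real.exp (c * p.1.energy) * p.1.deriv p.2) :=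
    ((Real.continuous_exp.comp (continuous_const.mul
      (continuous_energy.comp continuous_fst))).mul
      continuous_deriv_uncurry).measurable.ennreal_ofReal
  rw [lintegral_prod _ hmeas.aemeasurable]
  refine lintegral_congr fun φ => ?_
  rw [φ.lintegral_comp_mul_deriv (g := fun _ => Real.exp (c * φ.energy)) continuous_const
    fun _ => Real.exp_nonneg _, lintegral_const, UnitAddCircle.measure_univ, mul_one]

theorem IsQuasiInvariant.partitionFunction_neg_sq_eq (hσ : 0 < σsq) (hν : IsQuasiInvariant σsq 0 ν)
    (hb : 0 < b) (hbl : b < l) (hfin : partitionFunction σsq ν (-b ^ 2) ≠ ∞) :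
    partitionFunction σsq ν (-l ^ 2) = ∫⁻ p : CircleDiff 1 × UnitAddCircle,
      ENNReal.ofReal (Real.exp (1 / σsq * (-(2 * b ^ 2) * p.1.energy
        - 4 * b * (Real.cosh l - Real.cosh b) / Real.sinh b * p.1.deriv p.2)) * p.1.deriv p.2)
        ∂ν.prod volume := by
  have := sFinite_of_partitionFunction_ne_top hfin
  choose ψ hψ using fun n => exists_schwarzian_sub_eq_kink hb hbl (continuous_circleBump n)
    (circleBump_nonneg n) (circleBump_zero_ne_zero n)
  have hV := fun n => continuous_kinkPotential hb hbl (continuous_circleBump n)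
    (circleBump_nonneg n) (circleBump_zero_ne_zero n)
  have hprod := fun n => hν.partitionFunction_eq_lintegral_prod (-l ^ 2) (ψ n)
    (W := fun x => -(2 * b ^ 2) - kinkPotential l b (circleBump n) x)
    fun x => by rw [← hψ, mul_neg, neg_mul, sub_eq_add_neg]
  have haction : ∀ n (p : CircleDiff 1 × UnitAddCircle),
      action (fun x => -(2 * b ^ 2) - kinkPotential l b (circleBump n) (x - p.1.toFun p.2)) p.1
        = -(2 * b ^ 2) * p.1.energy
          - action (fun x => kinkPotential l b (circleBump n) (x - p.1.toFun p.2)) p.1 :=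
    fun n p => action_const_sub _ ((hV n).comp (continuous_sub_right (p.1.toFun p.2))) p.1
  have hdom : ∫⁻ p : CircleDiff 1 × UnitAddCircle, ENNReal.ofReal
      (Real.exp (2 * -b ^ 2 / σsq * p.1.energy) * p.1.deriv p.2) ∂ν.prod volume ≠ ∞ := by
    rwa [lintegral_exp_energy_mul_deriv]
  refine tendsto_nhds_unique (tendsto_const_nhds.congr hprod)
    (tendsto_lintegral_of_dominated_convergence _ (fun n =>
      measurable_exp_action_sub_mul_deriv _ (continuous_const.sub (hV n)))
      (fun n => ae_of_all _ fun p => ?_) hdom (ae_of_all _ fun p => ?_))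
  · have hnonneg := action_nonneg
      (fun x => kinkPotential_nonneg hb hbl (circleBump_nonneg n) (x - p.1.toFun p.2)) p.1
    have hpos := p.1.deriv_pos p.2
    beta_reduce
    rw [haction, show 2 * -b ^ 2 / σsq * p.1.energy = 1 / σsq * (-(2 * b ^ 2) * p.1.energy) by ring]
    gcongr
    exact sub_le_self _ hnonneg
  · simp only [haction]
    exact (ENNReal.continuous_ofReal.tendsto _).comp (((Real.continuous_exp.tendsto _).comp
      ((tendsto_const_nhds.sub (tendsto_action_kinkPotential hb hbl p.1 p.2)).const_mul
        _)).mul_const _)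

end Averaging

/-! ### The integral equation -/

section IntegralEquation

variable {f g : ℝ → ℝ} {B b c K σsq : ℝ} {ν : Measure (CircleDiff 1)}

theorem continuousAt_integral_Ioi (hg : IntegrableOn g (Set.Ioi B)) (hb : B < b) :
    ContinuousAt (fun x => ∫ t in Set.Ioi x, g t) b := by
  have hint : IntervalIntegrable g volume B (b + 1) := by
    rw [intervalIntegrable_iff_integrableOn_Ioc_of_le (by linarith)]
    exact hg.mono_set Set.Ioc_subset_Ioi_self
  have hprim : ContinuousAt (fun x => ∫ t in B..x, g t) b :=
    (intervalIntegral.continuousOn_primitive_interval' hint Set.left_mem_uIcc).continuousAt <| by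
      rw [Set.uIcc_of_le (by linarith)]
      exact Icc_mem_nhds hb (by linarith)
  refine (continuousAt_const (y := ∫ t in Set.Ioi B, g t)).sub hprim |>.congr ?_
  filter_upwards [Ioi_mem_nhds hb] with x hx
  rw [Pi.sub_apply, ← intervalIntegral.integral_Ioi_sub_Ioi' hg
    (hg.mono_set (Set.Ioi_subset_Ioi (le_of_lt hx))), sub_sub_cancel]

theorem hasDerivAt_integral_Ioi (hg : IntegrableOn g (Set.Ioi B))
    (hcont : ContinuousOn g (Set.Ioi B)) (hb : B < b) :
    HasDerivAt (fun x => ∫ t in Set.Ioi x, g t) (-g b) b := by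
  have hprim : HasDerivAt (fun x => ∫ t in b..x, g t) (g b) b :=
    intervalIntegral.integral_hasDerivAt_right IntervalIntegrable.refl
      (hcont.stronglyMeasurableAtFilter isOpen_Ioi b hb) (hcont.continuousAt (Ioi_mem_nhds hb))
  refine (hprim.const_sub (∫ t in Set.Ioi b, g t)).congr_of_eventuallyEq ?_
  filter_upwards [Ioi_mem_nhds hb] with x hx
  rw [← intervalIntegral.integral_Ioi_sub_Ioi' (hg.mono_set (Set.Ioi_subset_Ioi hb.le))
    (hg.mono_set (Set.Ioi_subset_Ioi (le_of_lt hx))), sub_sub_cancel]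

theorem exists_eq_mul_exp_of_eq_integral_Ioi
    (hint : ∀ b > B, IntegrableOn (fun l => c * (l * f l)) (Set.Ioi b))
    (heq : ∀ b > B, f b = ∫ l in Set.Ioi b, c * (l * f l)) :
    ∃ C, ∀ b > B, f b = C * Real.exp (-(c / 2 * b ^ 2)) := by
  have hcont : ContinuousOn (fun l => c * (l * f l)) (Set.Ioi B) := by
    refine continuousOn_const.mul (continuousOn_id.mul fun b hb => ?_)
    obtain ⟨x, hBx, hxb⟩ := exists_between (Set.mem_Ioi.1 hb)
    refine ((continuousAt_integral_Ioi (hint x hBx) hxb).congr ?_).continuousWithinAt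
    filter_upwards [Ioi_mem_nhds hb] with y hy using (heq y hy).symm
  have hderiv : ∀ b > B, HasDerivAt f (-(c * (b * f b))) b := by
    intro b hb
    obtain ⟨x, hBx, hxb⟩ := exists_between hb
    refine (hasDerivAt_integral_Ioi (hint x hBx) (hcont.mono (Set.Ioi_subset_Ioi hBx.le))
      hxb).congr_of_eventuallyEq ?_
    filter_upwards [Ioi_mem_nhds hb] with y hy using heq y hy
  let u : ℝ → ℝ := fun b => f b * Real.exp (c / 2 * b ^ 2)
  have hu : ∀ b > B, HasDerivAt u 0 b := fun b hb =>
    ((hderiv b hb).mul (((hasDerivAt_pow 2 b).const_mul (c / 2)).exp)).congr_deriv (by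
      norm_num
      ring)
  refine ⟨u (B + 1), fun b hb => ?_⟩
  have hconst : u b = u (B + 1) := isOpen_Ioi.is_const_of_deriv_eq_zero isPreconnected_Ioi
    (fun x hx => (hu x hx).differentiableAt.differentiableWithinAt) (fun x hx => (hu x hx).deriv)
    hb (lt_add_one B)
  rw [← hconst, mul_assoc, ← Real.exp_add, add_neg_cancel, Real.exp_zero, mul_one]

theorem exists_eq_mul_exp_of_eq_lintegral_Ioi (hB : 0 ≤ B) (hc : 0 ≤ c) (hf : Measurable f)
    (hf0 : ∀ b > B, 0 ≤ f b)
    (heq : ∀ b > B, ENNReal.ofReal (f b) = ∫⁻ l in Set.Ioi b, ENNReal.ofReal (c * (l * f l))) :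
    ∃ C, ∀ b > B, f b = C * Real.exp (-(c / 2 * b ^ 2)) := by
  have hmeas : Measurable fun l => c * (l * f l) := by fun_prop
  have hnonneg : ∀ b > B, 0 ≤ᵐ[volume.restrict (Set.Ioi b)] fun l => c * (l * f l) := by
    intro b hb
    filter_upwards [ae_restrict_mem measurableSet_Ioi] with l hl
    have hBl : B < l := hb.trans hl
    exact mul_nonneg hc (mul_nonneg (hB.trans hBl.le) (hf0 l hBl))
  refine exists_eq_mul_exp_of_eq_integral_Ioi (fun b hb => ⟨hmeas.aestronglyMeasurable, ?_⟩)
    fun b hb => ?_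
  · rw [hasFiniteIntegral_iff_ofReal (hnonneg b hb), ← heq b hb]
    exact ENNReal.ofReal_lt_top
  · rw [integral_eq_lintegral_of_nonneg_ae (hnonneg b hb) hmeas.aestronglyMeasurable, ← heq b hb,
      ENNReal.toReal_ofReal (hf0 b hb)]

theorem lintegral_exp_neg_mul_mul_Ioi (hc : 0 < c) :
    ∫⁻ s in Set.Ioi (0 : ℝ), ENNReal.ofReal (Real.exp (-(s * c)) * c) = 1 := by
  have hint : IntegrableOn (fun s : ℝ => Real.exp (-c * s)) (Set.Ioi 0) :=
    exp_neg_integrableOn_Ioi 0 hc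
  simp only [fun s : ℝ => show -(s * c) = -c * s by ring]
  rw [← ofReal_integral_eq_lintegral_ofReal (hint.mul_const c) (ae_of_all _ fun s => by positivity),
    integral_mul_const, integral_exp_mul_Ioi (neg_lt_zero.2 hc), mul_zero, Real.exp_zero,
    neg_div_neg_eq, one_div_mul_cancel hc.ne', ENNReal.ofReal_one]

theorem bijOn_mul_cosh_sub_cosh (hb : 0 ≤ b) (hK : 0 < K) :
    Set.BijOn (fun l => K * (Real.cosh l - Real.cosh b)) (Set.Ioi b) (Set.Ioi 0) := by
  have hcosh : StrictMonoOn Real.cosh (Set.Ici 0) := Real.cosh_strictMonoOn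
  refine ⟨fun l hl => ?_, fun x hx y hy hxy => ?_, fun y hy => ?_⟩
  · exact mul_pos hK (sub_pos.2 (hcosh hb (hb.trans (le_of_lt hl)) hl))
  · exact hcosh.injOn (hb.trans (le_of_lt hx)) (hb.trans (le_of_lt hy))
      (sub_left_injective (mul_left_cancel₀ hK.ne' hxy))
  · have hyK : 0 < y / K := div_pos hy hK
    have hone : 1 ≤ Real.cosh b + y / K := by linarith [Real.one_le_cosh b]
    refine ⟨Real.arcosh (Real.cosh b + y / K), ?_, ?_⟩
    · refine (hcosh.lt_iff_lt hb (Real.arcosh_nonneg hone)).1 ?_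
      rw [Real.cosh_arcosh hone]
      exact lt_add_of_pos_right _ hyK
    · beta_reduce
      rw [Real.cosh_arcosh hone, add_sub_cancel_left, mul_div_cancel₀ _ hK.ne']

theorem lintegral_Ioi_eq_lintegral_sinh_mul (hb : 0 ≤ b) (hK : 0 < K) (g : ℝ → ℝ≥0∞) :
    ∫⁻ s in Set.Ioi (0 : ℝ), g s = ∫⁻ l in Set.Ioi b,
      ENNReal.ofReal (K * Real.sinh l) * g (K * (Real.cosh l - Real.cosh b)) := by
  have hbij := bijOn_mul_cosh_sub_cosh hb hK
  rw [← hbij.image_eq, lintegral_image_eq_lintegral_abs_deriv_mul measurableSet_Ioi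
    (fun l _ => (((Real.hasDerivAt_cosh l).sub_const _).const_mul K).hasDerivWithinAt) hbij.injOn]
  refine setLIntegral_congr_fun measurableSet_Ioi fun l hl => ?_
  rw [abs_of_pos (mul_pos hK (Real.sinh_pos_iff.2 (hb.trans_lt hl)))]

open CircleDiff in
theorem lintegral_lintegral_exp_sub_mul_deriv [SFinite ν] (c : ℝ) :
    ∫⁻ s in Set.Ioi (0 : ℝ), ∫⁻ p : CircleDiff 1 × UnitAddCircle, ENNReal.ofReal
      (Real.exp (c * p.1.energy - s * p.1.deriv p.2) * p.1.deriv p.2) ∂ν.prod volume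
      = ∫⁻ φ, ENNReal.ofReal (Real.exp (c * φ.energy)) ∂ν := by
  have hderiv : Continuous fun q : ℝ × CircleDiff 1 × UnitAddCircle => q.2.1.deriv q.2.2 :=
    continuous_deriv_uncurry.comp continuous_snd
  have henergy : Continuous fun q : ℝ × CircleDiff 1 × UnitAddCircle => q.2.1.energy :=
    continuous_energy.comp continuous_snd.fst
  have hF : Continuous fun q : ℝ × CircleDiff 1 × UnitAddCircle =>
      Real.exp (c * q.2.1.energy - q.1 * q.2.1.deriv q.2.2) * q.2.1.deriv q.2.2 := by fun_prop
  have hinner : ∀ p : CircleDiff 1 × UnitAddCircle, ∫⁻ s in Set.Ioi (0 : ℝ), ENNReal.ofReal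
      (Real.exp (c * p.1.energy - s * p.1.deriv p.2) * p.1.deriv p.2)
        = ENNReal.ofReal (Real.exp (c * p.1.energy)) := by
    intro p
    simp only [sub_eq_add_neg, Real.exp_add, mul_assoc,
      ENNReal.ofReal_mul (Real.exp_nonneg (c * _))]
    rw [lintegral_const_mul _ (by fun_prop), lintegral_exp_neg_mul_mul_Ioi (p.1.deriv_pos p.2),
      mul_one]
  rw [lintegral_lintegral_swap hF.measurable.ennreal_ofReal.aemeasurable]
  simp only [hinner]
  rw [lintegral_prod (fun p : CircleDiff 1 × UnitAddCircle =>
    ENNReal.ofReal (Real.exp (c * p.1.energy)))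
    ((measurable_exp_energy c).comp measurable_fst).aemeasurable]
  simp only [lintegral_const, UnitAddCircle.measure_univ, mul_one]

theorem IsQuasiInvariant.partitionFunction_neg_sq_eq_lintegral_Ioi (hσ : 0 < σsq)
    (hν : IsQuasiInvariant σsq 0 ν) (hb : 0 < b) (hfin : partitionFunction σsq ν (-b ^ 2) ≠ ∞) :
    partitionFunction σsq ν (-b ^ 2) = ∫⁻ l in Set.Ioi b,
      ENNReal.ofReal (4 * b / (σsq * Real.sinh b) * Real.sinh l)
        * partitionFunction σsq ν (-l ^ 2) := by
  have := sFinite_of_partitionFunction_ne_top hfin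
  have := Real.sinh_pos_iff.2 hb
  rw [partitionFunction, ← lintegral_lintegral_exp_sub_mul_deriv,
    lintegral_Ioi_eq_lintegral_sinh_mul hb.le (K := 4 * b / (σsq * Real.sinh b)) (by positivity)]
  refine setLIntegral_congr_fun measurableSet_Ioi fun l hl => ?_
  rw [hν.partitionFunction_neg_sq_eq hσ hb hl hfin]
  refine congrArg _ (lintegral_congr fun p => ?_)
  congr 3
  field_simp

theorem IsQuasiInvariant.exists_partitionFunction_neg_sq_eq (hσ : 0 < σsq)
    (hν : IsQuasiInvariant σsq 0 ν) (hB : 0 ≤ B)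
    (hfin : ∀ b > B, partitionFunction σsq ν (-b ^ 2) ≠ ∞) :
    ∃ C : ℝ, ∀ b > B, (partitionFunction σsq ν (-b ^ 2)).toReal
      = C * (b / Real.sinh b * Real.exp (-(2 * b ^ 2 / σsq))) := by
  let f : ℝ → ℝ := fun b => Real.sinh b / b * (partitionFunction σsq ν (-b ^ 2)).toReal
  have hZ : Measurable (partitionFunction σsq ν) := (partitionFunction_mono hσ).measurable
  have hsinh : ∀ b > B, 0 < Real.sinh b := fun b hb => Real.sinh_pos_iff.2 (hB.trans_lt hb)
  have hf0 : ∀ b > B, 0 ≤ f b := fun b hb => by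
    have := hsinh b hb
    have := hB.trans_lt hb
    positivity
  have heq : ∀ b > B, ENNReal.ofReal (f b)
      = ∫⁻ l in Set.Ioi b, ENNReal.ofReal (4 / σsq * (l * f l)) := by
    intro b hb
    have hb0 := hB.trans_lt hb
    have := hsinh b hb
    rw [ENNReal.ofReal_mul (by positivity), ENNReal.ofReal_toReal (hfin b hb),
      hν.partitionFunction_neg_sq_eq_lintegral_Ioi hσ hb0 (hfin b hb),
      ← lintegral_const_mul' _ _ ENNReal.ofReal_ne_top]
    refine setLIntegral_congr_fun measurableSet_Ioi fun l hl => ?_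
    have hl0 : 0 < l := hb0.trans hl
    have := hsinh l (hb.trans hl)
    rw [← mul_assoc, ← ENNReal.ofReal_mul (by positivity),
      ← ENNReal.ofReal_toReal (hfin l (hb.trans hl)), ← ENNReal.ofReal_mul (by positivity)]
    congr 1
    simp only [f]
    field_simp
  obtain ⟨C, hC⟩ := exists_eq_mul_exp_of_eq_lintegral_Ioi hB (by positivity) (by fun_prop) hf0 heq
  refine ⟨C, fun b hb => ?_⟩
  have hb0 := (hB.trans_lt hb).ne'
  have hsb := (hsinh b hb).ne'
  rw [show 2 * b ^ 2 / σsq = 4 / σsq / 2 * b ^ 2 by ring, mul_left_comm, ← hC b hb]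
  simp only [f]
  field_simp

end IntegralEquation

/-! ### The entire function `sin √w / √w` -/

section SincSqrt

/-- The entire function `w ↦ sin √w / √w`, which turns `sin α / α` into a function of `α²`. -/
noncomputable def sincSqrt (w : ℂ) : ℂ :=
  ∑' n : ℕ, (-1) ^ n * w ^ n / ((2 * n + 1).factorial : ℂ)

theorem norm_sincSqrt_term_le {w : ℂ} {R : ℝ} (hw : ‖w‖ ≤ R) (n : ℕ) :
    ‖(-1) ^ n * w ^ n / ((2 * n + 1).factorial : ℂ)‖ ≤ R ^ n / (n.factorial : ℝ) := by
  rw [norm_div, norm_mul, norm_pow, norm_pow, norm_neg, norm_one, one_pow, one_mul,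
    Complex.norm_natCast]
  have hfact : (n.factorial : ℝ) ≤ ((2 * n + 1).factorial : ℝ) := by
    exact_mod_cast Nat.factorial_le (by omega)
  have : (0 : ℝ) < n.factorial := by exact_mod_cast n.factorial_pos
  have := (norm_nonneg w).trans hw
  gcongr

theorem differentiable_sincSqrt : Differentiable ℂ sincSqrt := by
  intro w
  have hball : DifferentiableOn ℂ sincSqrt (Metric.ball 0 (‖w‖ + 1)) :=
    Complex.differentiableOn_tsum_of_summable_norm (Real.summable_pow_div_factorial (‖w‖ + 1))
      (fun n => by fun_prop) Metric.isOpen_ball fun n x hx =>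
        norm_sincSqrt_term_le (mem_ball_zero_iff.1 hx).le n
  exact hball.differentiableAt (Metric.isOpen_ball.mem_nhds (by simp))

theorem mul_sincSqrt_sq (z : ℂ) : z * sincSqrt (z ^ 2) = Complex.sin z := by
  rw [sincSqrt, ← tsum_mul_left, ← (Complex.hasSum_sin z).tsum_eq]
  refine tsum_congr fun n => ?_
  ring

theorem sincSqrt_zero : sincSqrt 0 = 1 := by
  rw [sincSqrt, tsum_eq_single 0 fun n hn => by simp [hn]]
  simp

theorem inv_sincSqrt_sq (α : ℂ) : (sincSqrt (α ^ 2))⁻¹ = divSin α := by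
  rw [divSin]
  split_ifs with h
  · rw [h, zero_pow two_ne_zero, sincSqrt_zero, inv_one]
  · rw [← mul_sincSqrt_sq, div_mul_eq_div_div, div_self h, one_div]

theorem sincSqrt_neg_sq {b : ℝ} (hb : b ≠ 0) :
    sincSqrt ((-b ^ 2 : ℝ) : ℂ) = ((Real.sinh b / b : ℝ) : ℂ) := by
  have hsin := mul_sincSqrt_sq (b * Complex.I)
  rw [Complex.sin_mul_I, mul_pow, Complex.I_sq, mul_right_comm] at hsin
  have hmul := mul_right_cancel₀ Complex.I_ne_zero hsin
  push_cast
  rw [eq_div_iff (Complex.ofReal_ne_zero.2 hb), ← hmul, mul_neg_one, mul_comm]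

theorem exists_eq_sq_of_sincSqrt_eq_zero {w : ℂ} (hw : sincSqrt w = 0) :
    ∃ k : ℤ, k ≠ 0 ∧ w = (((k * Real.pi) ^ 2 : ℝ) : ℂ) := by
  obtain ⟨z, rfl⟩ := IsAlgClosed.exists_pow_nat_eq w two_pos
  have hsin : Complex.sin z = 0 := by rw [← mul_sincSqrt_sq, hw, mul_zero]
  obtain ⟨k, rfl⟩ := Complex.sin_eq_zero_iff.1 hsin
  refine ⟨k, ?_, by push_cast; rfl⟩
  rintro rfl
  simp [sincSqrt_zero] at hw

theorem sincSqrt_ne_zero {w : ℂ} {c : ℝ} (hw : w ∈ Metric.ball (c : ℂ) (Real.pi ^ 2 - c)) :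
    sincSqrt w ≠ 0 := by
  intro hzero
  obtain ⟨k, hk, rfl⟩ := exists_eq_sq_of_sincSqrt_eq_zero hzero
  have hone : (1 : ℝ) ≤ (k : ℝ) ^ 2 := by
    have : 0 < k ^ 2 := by positivity
    exact_mod_cast this
  have hle : Real.pi ^ 2 ≤ (k * Real.pi) ^ 2 := by
    rw [mul_pow]
    exact le_mul_of_one_le_left (sq_nonneg _) hone
  rw [Metric.mem_ball, dist_eq_norm, ← Complex.ofReal_sub, Complex.norm_real] at hw
  linarith [Real.le_norm_self ((k * Real.pi) ^ 2 - c)]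

/-- The factor `(α / sin α) e^{2α²/σ²}` as a function of `w = α²`. -/
noncomputable def orbitalFactor (σsq : ℝ) (w : ℂ) : ℂ :=
  Complex.exp (2 * w / σsq) * (sincSqrt w)⁻¹

theorem orbitalFactor_sq (σsq : ℝ) (α : ℂ) :
    orbitalFactor σsq (α ^ 2) = divSin α * Complex.exp (2 * α ^ 2 / σsq) := by
  rw [orbitalFactor, inv_sincSqrt_sq, mul_comm]

theorem orbitalFactor_zero (σsq : ℝ) : orbitalFactor σsq 0 = 1 := by
  rw [orbitalFactor, sincSqrt_zero, mul_zero, zero_div, Complex.exp_zero, inv_one, mul_one]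

theorem orbitalFactor_neg_sq (σsq : ℝ) {b : ℝ} (hb : b ≠ 0) :
    orbitalFactor σsq ((-b ^ 2 : ℝ) : ℂ)
      = ((b / Real.sinh b * Real.exp (-(2 * b ^ 2 / σsq)) : ℝ) : ℂ) := by
  rw [orbitalFactor, sincSqrt_neg_sq hb, ← Complex.ofReal_inv, inv_div, mul_comm]
  push_cast
  rw [mul_neg, neg_div]

theorem differentiableOn_orbitalFactor (σsq c : ℝ) :
    DifferentiableOn ℂ (orbitalFactor σsq) (Metric.ball (c : ℂ) (Real.pi ^ 2 - c)) := by
  intro w hw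
  have hexp : DifferentiableAt ℂ (fun w : ℂ => Complex.exp (2 * w / σsq)) w := by fun_prop
  exact (hexp.mul ((differentiable_sincSqrt w).inv (sincSqrt_ne_zero hw))).differentiableWithinAt

end SincSqrt

/-! ### Analytic continuation of the Laplace transform of a positive measure -/

section Continuation

open ProbabilityTheory

variable {Ω : Type*} [MeasurableSpace Ω] {ν : Measure Ω} {X : Ω → ℝ} {G : ℂ → ℂ} {a c r s : ℝ}

theorem ofReal_exp_mul_eq_tsum {x : ℝ} (hx : 0 ≤ x) (hca : c ≤ a) :
    ENNReal.ofReal (Real.exp (a * x)) = ∑' n : ℕ,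
      ENNReal.ofReal ((n.factorial : ℝ)⁻¹ * (a - c) ^ n)
        * ENNReal.ofReal (x ^ n * Real.exp (c * x)) := by
  have := sub_nonneg.2 hca
  have hsum : HasSum (fun n : ℕ => (n.factorial : ℝ)⁻¹ * (a - c) ^ n * (x ^ n * Real.exp (c * x)))
      (Real.exp (a * x)) := by
    have hexp := (NormedSpace.expSeries_div_hasSum_exp ((a - c) * x)).mul_right (Real.exp (c * x))
    rw [← Real.exp_eq_exp_ℝ, ← Real.exp_add, ← add_mul, sub_add_cancel] at hexp
    exact hexp.congr_fun fun n => by rw [mul_pow]; ring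
  rw [← hsum.tsum_eq, ENNReal.ofReal_tsum_of_nonneg (fun n => by positivity) hsum.summable]
  exact tsum_congr fun n => ENNReal.ofReal_mul (by positivity)

-- All terms of the Taylor series at `c` are nonnegative to the right of `c`, so by Tonelli its
-- convergence forces the integral to converge.
theorem lintegral_exp_eq_of_hasSum (hX : Measurable X) (hX0 : ∀ ω, 0 ≤ X ω) (hca : c ≤ a)
    (hc : c ∈ interior (integrableExpSet X ν))
    (hs : HasSum (fun n : ℕ => (n.factorial : ℝ)⁻¹ *
      ((a - c) ^ n * ∫ ω, X ω ^ n * Real.exp (c * X ω) ∂ν)) s) :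
    ∫⁻ ω, ENNReal.ofReal (Real.exp (a * X ω)) ∂ν = ENNReal.ofReal s := by
  have := sub_nonneg.2 hca
  have hnonneg : ∀ n ω, 0 ≤ X ω ^ n * Real.exp (c * X ω) := fun n ω =>
    mul_nonneg (pow_nonneg (hX0 ω) n) (Real.exp_nonneg _)
  have hint : ∀ n, 0 ≤ ∫ ω, X ω ^ n * Real.exp (c * X ω) ∂ν := fun n =>
    integral_nonneg (hnonneg n)
  simp only [fun ω => ofReal_exp_mul_eq_tsum (hX0 ω) hca]
  rw [lintegral_tsum fun n => by fun_prop, ← hs.tsum_eq, ENNReal.ofReal_tsum_of_nonneg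
    (fun n => mul_nonneg (by positivity) (mul_nonneg (by positivity) (hint n))) hs.summable]
  refine tsum_congr fun n => ?_
  rw [lintegral_const_mul _ (by fun_prop), ← mul_assoc,
    ENNReal.ofReal_mul (q := ∫ ω, X ω ^ n * Real.exp (c * X ω) ∂ν) (by positivity),
    ofReal_integral_eq_lintegral_ofReal
      (integrable_pow_mul_exp_of_mem_interior_integrableExpSet hc n) (ae_of_all _ (hnonneg n))]

theorem eventuallyEq_complexMGF (hc : c ∈ interior (integrableExpSet X ν))
    (hG : AnalyticAt ℂ G c) (heq : ∀ᶠ x : ℝ in 𝓝 c, G x = (mgf X ν x : ℝ)) :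
    G =ᶠ[𝓝 (c : ℂ)] complexMGF X ν := by
  refine (hG.frequently_eq_iff_eventually_eq
    (analyticAt_complexMGF (by rwa [Complex.ofReal_re]))).1 ?_
  have hreal : ∀ᶠ x : ℝ in 𝓝[≠] c, G x = complexMGF X ν x := by
    filter_upwards [heq.filter_mono nhdsWithin_le_nhds] with x hx
    rw [hx, complexMGF_ofReal]
  have hcoe : Tendsto (fun x : ℝ => (x : ℂ)) (𝓝[≠] c) (𝓝[≠] (c : ℂ)) :=
    Complex.continuous_ofReal.continuousWithinAt.tendsto_nhdsWithin fun x hx =>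
      Complex.ofReal_injective.ne hx
  exact hcoe.frequently hreal.frequently

theorem iteratedDeriv_complexMGF_ofReal (hc : c ∈ interior (integrableExpSet X ν)) (n : ℕ) :
    iteratedDeriv n (complexMGF X ν) c = ((∫ ω, X ω ^ n * Real.exp (c * X ω) ∂ν : ℝ) : ℂ) := by
  rw [iteratedDeriv_complexMGF (by rwa [Complex.ofReal_re]) n, ← integral_complex_ofReal]
  push_cast
  rfl

theorem hasSum_of_eventuallyEq_mgf (hc : c ∈ interior (integrableExpSet X ν))
    (hG : DifferentiableOn ℂ G (Metric.ball (c : ℂ) r))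
    (heq : ∀ᶠ x : ℝ in 𝓝 c, G x = (mgf X ν x : ℝ)) (har : |a - c| < r) :
    HasSum (fun n : ℕ => (((n.factorial : ℝ)⁻¹ * ((a - c) ^ n
      * ∫ ω, X ω ^ n * Real.exp (c * X ω) ∂ν) : ℝ) : ℂ)) (G a) := by
  have hball : (a : ℂ) ∈ Metric.ball (c : ℂ) r := by
    rwa [Metric.mem_ball, dist_eq_norm, ← Complex.ofReal_sub, Complex.norm_real]
  have hGc : AnalyticAt ℂ G c :=
    hG.analyticAt (Metric.ball_mem_nhds _ ((abs_nonneg _).trans_lt har))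
  refine (Complex.hasSum_taylorSeries_on_ball hG hball).congr_fun fun n => ?_
  rw [(eventuallyEq_complexMGF hc hGc heq).iteratedDeriv_eq n, iteratedDeriv_complexMGF_ofReal hc]
  simp only [smul_eq_mul]
  push_cast
  rfl

theorem mem_integrableExpSet_and_mgf_eq (hX : Measurable X) (hX0 : ∀ ω, 0 ≤ X ω)
    (hc : c ∈ interior (integrableExpSet X ν))
    (hG : DifferentiableOn ℂ G (Metric.ball (c : ℂ) r))
    (heq : ∀ᶠ x : ℝ in 𝓝 c, G x = (mgf X ν x : ℝ)) (hca : c ≤ a) (har : a - c < r) :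
    a ∈ integrableExpSet X ν ∧ (mgf X ν a : ℂ) = G a := by
  have hac : 0 ≤ a - c := sub_nonneg.2 hca
  have hsum := hasSum_of_eventuallyEq_mgf hc hG heq ((abs_of_nonneg hac).trans_lt har)
  have hre := Complex.hasSum_re hsum
  have him := Complex.hasSum_im hsum
  simp only [Complex.ofReal_re] at hre
  simp only [Complex.ofReal_im] at him
  have hexp := lintegral_exp_eq_of_hasSum hX hX0 hca hc hre
  have hmeas : AEStronglyMeasurable (fun ω => Real.exp (a * X ω)) ν :=
    (by fun_prop : Measurable fun ω => Real.exp (a * X ω)).aestronglyMeasurable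
  have hnonneg : 0 ≤ᵐ[ν] fun ω => Real.exp (a * X ω) := ae_of_all _ fun ω => Real.exp_nonneg _
  have hGa : 0 ≤ (G a).re := hre.nonneg fun n =>
    mul_nonneg (by positivity) (mul_nonneg (by positivity) (integral_nonneg fun ω =>
      mul_nonneg (pow_nonneg (hX0 ω) n) (Real.exp_nonneg _)))
  refine ⟨⟨hmeas, ?_⟩, Complex.ext ?_ (hasSum_zero.unique him)⟩
  · rw [hasFiniteIntegral_iff_ofReal hnonneg, hexp]
    exact ENNReal.ofReal_lt_top
  · rw [Complex.ofReal_re, mgf, integral_eq_lintegral_of_nonneg_ae hnonneg hmeas, hexp,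
      ENNReal.toReal_ofReal hGa]

end Continuation

/-! ### The partition function -/

section PartitionFunction

open ProbabilityTheory

variable {σsq a a₁ : ℝ} {ν : Measure (CircleDiff 1)}

theorem mgf_energy (σsq a : ℝ) (ν : Measure (CircleDiff 1)) :
    mgf (fun φ => 2 / σsq * φ.energy) ν a = (partitionFunction σsq ν a).toReal := by
  rw [mgf, partitionFunction, integral_eq_lintegral_of_nonneg_ae
    (ae_of_all _ fun φ => Real.exp_nonneg _)]
  · simp only [fun φ : CircleDiff 1 =>
      show a * (2 / σsq * φ.energy) = 2 * a / σsq * φ.energy by ring]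
  · have := CircleDiff.continuous_energy
    exact Continuous.aestronglyMeasurable (by fun_prop)

theorem mem_integrableExpSet_energy :
    a ∈ integrableExpSet (fun φ => 2 / σsq * φ.energy) ν ↔ partitionFunction σsq ν a ≠ ∞ := by
  have := CircleDiff.continuous_energy
  have hmeas : AEStronglyMeasurable (fun φ : CircleDiff 1 =>
    Real.exp (a * (2 / σsq * φ.energy))) ν := Continuous.aestronglyMeasurable (by fun_prop)
  rw [integrableExpSet, Set.mem_ofPred_eq, Integrable, and_iff_right hmeas,
    hasFiniteIntegral_iff_ofReal (ae_of_all _ fun φ => Real.exp_nonneg _), lt_top_iff_ne_top,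
    partitionFunction]
  simp only [fun φ : CircleDiff 1 =>
    show a * (2 / σsq * φ.energy) = 2 * a / σsq * φ.energy by ring]

theorem IsQuasiInvariant.exists_partitionFunction_eq_of_lt (hσ : 0 < σsq)
    (hν : IsQuasiInvariant σsq 0 ν) (hfin : partitionFunction σsq ν a₁ ≠ ∞) :
    ∃ C : ℝ, ∀ a < -|a₁|,
      ((partitionFunction σsq ν a).toReal : ℂ) = C * orbitalFactor σsq a := by
  have hfin' : ∀ b > √|a₁|, partitionFunction σsq ν (-b ^ 2) ≠ ∞ := fun b hb => by
    have hsq : |a₁| < b ^ 2 := Real.lt_sq_of_sqrt_lt hb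
    exact ne_top_of_le_ne_top hfin
      (partitionFunction_mono hσ (by linarith [neg_abs_le a₁]))
  obtain ⟨C, hC⟩ := hν.exists_partitionFunction_neg_sq_eq hσ (Real.sqrt_nonneg _) hfin'
  refine ⟨C, fun a ha => ?_⟩
  obtain ⟨b, hb, rfl⟩ : ∃ b > √|a₁|, a = -b ^ 2 := by
    refine ⟨√(-a), Real.sqrt_lt_sqrt (abs_nonneg _) (by linarith), ?_⟩
    rw [Real.sq_sqrt (by linarith [abs_nonneg a₁]), neg_neg]
  rw [orbitalFactor_neg_sq σsq ((Real.sqrt_nonneg _).trans_lt hb).ne', hC b hb,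
    Complex.ofReal_mul]

theorem IsQuasiInvariant.exists_partitionFunction_eq (hσ : 0 < σsq)
    (hν : IsQuasiInvariant σsq 0 ν) (hfin : partitionFunction σsq ν a₁ ≠ ∞) :
    ∃ C : ℝ, ∀ a < Real.pi ^ 2, partitionFunction σsq ν a ≠ ∞ ∧
      ((partitionFunction σsq ν a).toReal : ℂ) = C * orbitalFactor σsq a := by
  obtain ⟨C, hC⟩ := hν.exists_partitionFunction_eq_of_lt hσ hfin
  have hleft : ∀ a < -|a₁|, partitionFunction σsq ν a ≠ ∞ := fun a ha =>
    ne_top_of_le_ne_top hfin (partitionFunction_mono hσ (ha.le.trans (neg_abs_le a₁)))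
  refine ⟨C, fun a ha => ?_⟩
  obtain ⟨c, hc⟩ := exists_lt (-|a₁|)
  rcases lt_or_ge a c with hac | hca
  · exact ⟨hleft a (hac.trans hc), hC a (hac.trans hc)⟩
  have hint : c ∈ interior (integrableExpSet (fun φ => 2 / σsq * φ.energy) ν) :=
    mem_interior.2 ⟨Set.Iio (-|a₁|), fun x hx => mem_integrableExpSet_energy.2 (hleft x hx),
      isOpen_Iio, hc⟩
  have heq : ∀ᶠ x : ℝ in 𝓝 c, (C : ℂ) * orbitalFactor σsq x
      = (mgf (fun φ => 2 / σsq * φ.energy) ν x : ℝ) := by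
    filter_upwards [Iio_mem_nhds hc] with x hx
    rw [mgf_energy, hC x hx]
  rw [← mgf_energy, ← mem_integrableExpSet_energy]
  exact mem_integrableExpSet_and_mgf_eq (CircleDiff.continuous_energy.measurable.const_mul _)
    (fun φ => mul_nonneg (by positivity) φ.energy_nonneg) hint
    ((differentiableOn_orbitalFactor σsq c).const_mul _) heq hca (sub_lt_sub_right ha c)

end PartitionFunction

theorem mainTheorem3_general (σsq a₀ : ℝ) (hσ : 0 < σsq) (μ : Measure (CircleDiff 1))
    (hμ : IsQuasiInvariant σsq a₀ μ)
    (hfin : ∃ a, changeOfOrbit σsq a₀ a μ Set.univ < ∞) :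
    (∀ a : ℝ, a < Real.pi ^ 2 → changeOfOrbit σsq a₀ a μ Set.univ < ∞) ∧
    ∀ (a : ℝ) (α : ℂ), α ^ 2 = (a : ℂ) → a < Real.pi ^ 2 →
      ((changeOfOrbit σsq a₀ a μ Set.univ).toReal : ℂ) =
        divSin α * Complex.exp (2 * α ^ 2 / (σsq : ℂ))
          * ((changeOfOrbit σsq a₀ 0 μ Set.univ).toReal : ℂ) := by
  simp only [changeOfOrbit_univ, lt_top_iff_ne_top] at hfin ⊢
  obtain ⟨a₁, ha₁⟩ := hfin
  obtain ⟨C, hC⟩ := (hμ.changeOfOrbit 0).exists_partitionFunction_eq hσ ha₁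
  refine ⟨fun a ha => (hC a ha).1, fun a α hα ha => ?_⟩
  rw [(hC a ha).2, (hC 0 (by positivity)).2, ← hα, orbitalFactor_sq, Complex.ofReal_zero,
    orbitalFactor_zero, mul_one, mul_comm]

theorem mainTheorem3 (σsq : ℝ) (hσ : 0 < σsq) (μ : ℝ → Measure (CircleDiff 1))
    (hμ : IsRegularOrbitalFamily σsq μ) :
    (∀ a : ℝ, a < Real.pi ^ 2 → μ a Set.univ < ∞) ∧
    ∀ (a : ℝ) (α : ℂ), α ^ 2 = (a : ℂ) → a < Real.pi ^ 2 →
      (((μ a Set.univ).toReal : ℝ) : ℂ) =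
        divSin α * Complex.exp (2 * α ^ 2 / (σsq : ℂ)) * (((μ 0 Set.univ).toReal : ℝ) : ℂ) := by
  obtain ⟨a₀, hreg, hμ⟩ := hμ
  simpa only [← hμ] using
    mainTheorem3_general σsq a₀ hσ (μ a₀) hreg.orbital.isQuasiInvariant hreg.regular
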